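/- Let $\mathbb K=\mathbb R$ or $\mathbb C$. For $k\ge 1$ a *homogeneous Lie polynomial of degree $k$* is a $\mathbb K$-linear combination, in the free Lie algebra on two letters, of nested Lie brackets containing exactly $k$ letters; its value at bounded linear operators $A,B$ on a Banach space is obtained by inserting $A$ and $B$ for the letters, with $[S,T]=ST-TS$ (in degree $1$ it is a linear combination of $A$ and $B$). Products $\prod_{k=q}^{m}$ of operators are ordered with increasing index from left to right, and equal $I$ if $m<q$. All $O$-terms are in operator norm, as $t\to 0$, $t\in\mathbb R$. Let $X$ range over the Banach spaces over $\mathbb K$, and $A,B$ over the bounded linear operators on $X$. (0) For $T>0$ and $c_0\in X$, the unique solution on $[0,T]$ of the Cauchy problem $c'(t)=Ac(t)+Bc(t)$, $c(0)=c_0$, is $c(t)=\exp((A+B)t)c_0$. (1) Let $a_1,\dots,a_j,b_1,\dots,b_j\in\mathbb K$ and $S(t)=\prod_{i=1}^{j}\exp(a_iAt)\exp(b_iBt)$. There are homogeneous Lie polynomials $C_k$ of degree $k$ ($k\ge1$), depending only on the $a_i,b_i$ (and not on $X,A,B$), such that, for all $X,A,B$ and every $p\ge 0$ with $\exp((A+B)t)=S(t)+O(t^{p+1})$,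 one has for all $m\ge 0$ $$\exp((A+B)t)=\prod_{i=1}^{j}\exp(a_iAt)\exp(b_iBt)\prod_{k=p+1}^{m}\exp(C_k(A,B)t^k)+O(t^{m+1}).$$ Moreover there is $r>0$ (depending on $A,B$) such that for $|t|<r$ the right-hand products converge to $\exp((A+B)t)$ as $m\to\infty$; and for all $m\ge0$, $T>0$ there is $K$ such that the solution $c$ of the Cauchy problem with any initial value $c_0$ satisfies $$\Big\|c(t)-S(t)\prod_{k=p+1}^{m}\exp(C_k(A,B)t^k)c_0\Big\|\le K\,t^{m+1}\|c_0\|\qquad(0\le t\le T).$$ (2) The Lie–Trotter scheme $\exp(At)\exp(Bt)$ ($j=1$, $a_1=b_1=1$) satisfies the hypothesis of (1) with $p=1$, so its correction starts at $k=2$; the Strang scheme $\exp(At/2)\exp(Bt)\exp(At/2)$ ($j=2$, $a=(\tfrac12,\tfrac12)$, $b=(1,0)$) satisfies it with $p=2$, so its correction starts at $k=3$. (3) There are homogeneous Lie polynomials $\tilde C_k,C_k,D_k$ of degree $k$, not depending on $X,A,B$, such that for all $X,A,B$ and all $m\ge0$ $$\exp\big((\tfrac A2+\tfrac B2)t\big)=\prod_{k=2}^{m}\exp(\tilde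 C_kt^k)\exp(\tfrac A2t)\exp(\tfrac B2t)+O(t^{m+1}),$$ $$\exp\big((\tfrac B2+\tfrac A2)t\big)=\exp(\tfrac B2t)\exp(\tfrac A2t)\prod_{k=2}^{m}\exp(C_kt^k)+O(t^{m+1}),$$ $$\prod_{k=2}^{m}\exp(\tilde C_kt^k)\prod_{k=2}^{m}\exp(C_kt^k)=\prod_{k=3}^{m}\exp(D_kt^k)+O(t^{m+1}),$$ where $\tilde C_k,C_k,D_k$ are evaluated at $A,B$. Moreover, for $|t|<r$ with some $r>0$ depending on $A,B$, the three infinite products converge, the three relations hold exactly with $m=\infty$ and no error term, and $$\exp((A+B)t)=\prod_{k=2}^{\infty}\exp(\tilde C_kt^k)\,\exp(\tfrac A2t)\exp(Bt)\exp(\tfrac A2t)\prod_{k=2}^{\infty}\exp(C_kt^k).$$ -/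

import Mathlib

open Filter Topology Asymptotics

universe u v

noncomputable section

/-- Lie monomials of degree `k` in the two free generators `0, 1`: the generators have degree one,
and the bracket of monomials of degrees `k` and `l` is a monomial of degree `k + l`. -/
inductive IsLieMonomial (𝕜 : Type*) [CommRing 𝕜] : ℕ → FreeLieAlgebra 𝕜 (Fin 2) → Prop
  | of (i : Fin 2) : IsLieMonomial 𝕜 1 (FreeLieAlgebra.of 𝕜 i)
  | lie {k l : ℕ} {x y : FreeLieAlgebra 𝕜 (Fin 2)} :
      IsLieMonomial 𝕜 k x → IsLieMonomial 𝕜 l y → IsLieMonomial 𝕜 (k + l) ⁅x, y⁆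

/-- Homogeneous Lie polynomials of degree `k` in two letters: linear combinations of `k`-letter
nested brackets. -/
def lieHomogeneous (𝕜 : Type*) [CommRing 𝕜] (k : ℕ) : Submodule 𝕜 (FreeLieAlgebra 𝕜 (Fin 2)) :=
  Submodule.span 𝕜 {x | IsLieMonomial 𝕜 k x}

section Operators

attribute [local instance] LieRing.ofAssociativeRing

variable {𝕜 : Type*} [RCLike 𝕜] {X : Type*} [NormedAddCommGroup X] [NormedSpace 𝕜 X]

/-- The value of a Lie polynomial at the operators `A` and `B`, with `⁅S, T⁆ = S T - T S`. -/
def lieEval (A B : X →L[𝕜] X) (P : FreeLieAlgebra 𝕜 (Fin 2)) : X →L[𝕜] X :=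
  FreeLieAlgebra.lift 𝕜 ![A, B] P

/-- The exponential splitting scheme
`exp (a₁ A t) exp (b₁ B t) exp (a₂ A t) exp (b₂ B t) ⋯ exp (aⱼ A t) exp (bⱼ B t)`. -/
def splitting {j : ℕ} (a b : Fin j → 𝕜) (A B : X →L[𝕜] X) (t : ℝ) : X →L[𝕜] X :=
  (List.ofFn fun i : Fin j =>
    NormedSpace.exp ((a i * (t : 𝕜)) • A) * NormedSpace.exp ((b i * (t : 𝕜)) • B)).prod

/-- The splitting scheme agrees with `exp ((A + B) t)` up to `O(t ^ (p + 1))`. -/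
def SplittingHasOrder {j : ℕ} (a b : Fin j → 𝕜) (A B : X →L[𝕜] X) (p : ℕ) : Prop :=
  (fun t : ℝ => NormedSpace.exp ((t : 𝕜) • (A + B)) - splitting a b A B t)
    =O[𝓝 0] fun t : ℝ => t ^ (p + 1)

/-- The ordered product `exp (C_q t ^ q) exp (C_{q+1} t ^ (q+1)) ⋯ exp (C_m t ^ m)`, where `C_k` is
a Lie polynomial evaluated at `A` and `B`; it is `1` when `m < q`. -/
def zassenhausProd (C : ℕ → FreeLieAlgebra 𝕜 (Fin 2)) (A B : X →L[𝕜] X) (q m : ℕ) (t : ℝ) :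
    X →L[𝕜] X :=
  ((List.range' q (m + 1 - q)).map fun k =>
    NormedSpace.exp ((t : 𝕜) ^ k • lieEval A B (C k))).prod

/-- `c` solves the Cauchy problem `c' = A c + B c` on `[0, T]`, `c 0 = c₀`. -/
def IsCauchySolution [NormedSpace ℝ X] (A B : X →L[𝕜] X) (T : ℝ) (c₀ : X) (c : ℝ → X) : Prop :=
  c 0 = c₀ ∧ ∀ t ∈ Set.Icc 0 T, HasDerivWithinAt c (A (c t) + B (c t)) (Set.Icc 0 T) t

end Operators

end

/-! Let `R(t)` be a finite product of factors `exp (t c)`. Its logarithmic derivative `R' R⁻¹` is a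
power series `∑ tⁿ yₙ` whose coefficients are Lie polynomials in the `c`. Left multiplication by
`exp (tᵐ c)` turns this series into `exp (tᵐ ad c) y + m tᵐ⁻¹ c`, which involves brackets only. So
the factors can be split off one by one: `c = -yₘ₋₁ / m` cancels the coefficient of `tᵐ⁻¹`, and `-c`
is the Zassenhaus exponent `C_m`. No Baker-Campbell-Hausdorff formula is needed. The recursion runs
once in the free Lie algebra, which gives universality and homogeneity, and commutes with evaluation
at `A, B`.

Analysis enters in three places. If the first `m` coefficients vanish, Grönwall gives `R - 1 =
O(t^(m+1))` (`IsLogDeriv.norm_sub_one_le`). Conversely such an estimate forces the coefficients to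
vanish (`IsLogDeriv.eq_zero_of_isBigO`), so for a scheme of order `p` the factors up to `p` are
trivial and one sequence `C` serves every `p`. Finally, on a small disc the weighted `ℓ¹` norm of
the residual series never grows (`tsum_residualCoeff_le`), so the residuals tend to `1`
geometrically and the product converges.

The theorem applies this to the defect `S(t)⁻¹ exp ((A + B) t)` and to its analogues for the half
steps. -/

/-! ### Formal recursion for the Zassenhaus exponents -/

section LieSeries

open Finset.HasAntidiagonal
open scoped Nat

variable {L : Type*} [LieRing L] {L' : Type*} [LieRing L']

/-- The coefficient of `t ^ i` in the power series `exp (t ^ m • ad c)`. -/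
noncomputable def adExpCoeff (𝕜 : Type*) [Field 𝕜] [LieAlgebra 𝕜 L] (m : ℕ) (c : L) (i : ℕ) :
    Module.End 𝕜 L :=
  if m ∣ i then ((i / m)! : 𝕜)⁻¹ • LieAlgebra.ad 𝕜 L c ^ (i / m) else 0

/-- The coefficients of the power series `exp (t ^ m • ad c) y`. -/
noncomputable def conjCoeff (𝕜 : Type*) [Field 𝕜] [LieAlgebra 𝕜 L] (m : ℕ) (c : L) (y : ℕ → L)
    (n : ℕ) : L :=
  ∑ ij ∈ antidiagonal n, adExpCoeff 𝕜 m c ij.1 (y ij.2)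

/-- If `y` are the coefficients of the logarithmic derivative `R' R⁻¹`, these are the coefficients
of the logarithmic derivative of `exp (t ^ m • c) R`. -/
noncomputable def leftMulExp (𝕜 : Type*) [Field 𝕜] [LieAlgebra 𝕜 L] (m : ℕ) (c : L) (y : ℕ → L)
    (n : ℕ) : L :=
  conjCoeff 𝕜 m c y n + if n + 1 = m then (m : 𝕜) • c else 0

/-- The logarithmic derivative of the product of the `exp (t • c)` for `c` in a list. -/
noncomputable def logDerivCoeff (𝕜 : Type*) [Field 𝕜] [LieAlgebra 𝕜 L] : List L → ℕ → L
  | [] => 0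
  | c :: l => leftMulExp 𝕜 1 c (logDerivCoeff 𝕜 l)

/-- The logarithmic derivative of `exp (-C_m t ^ m) ⋯ exp (-C_1 t) R`, if `y` is that of `R` and
`C_k` are the Zassenhaus exponents of `R`. -/
noncomputable def residualCoeff (𝕜 : Type*) [Field 𝕜] [LieAlgebra 𝕜 L] (y : ℕ → L) : ℕ → ℕ → L
  | 0 => y
  | m + 1 =>
    leftMulExp 𝕜 (m + 1) (-(((m + 1 : ℕ) : 𝕜)⁻¹ • residualCoeff 𝕜 y m m)) (residualCoeff 𝕜 y m)

/-- The exponents `C_k` in `R = exp (C_1 t) exp (C_2 t ^ 2) ⋯`, in terms of the logarithmic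
derivative of `R`. -/
noncomputable def zassenhausExponent (𝕜 : Type*) [Field 𝕜] [LieAlgebra 𝕜 L] (y : ℕ → L) : ℕ → L
  | 0 => 0
  | m + 1 => ((m + 1 : ℕ) : 𝕜)⁻¹ • residualCoeff 𝕜 y m m

variable {𝕜 : Type*} [Field 𝕜] [LieAlgebra 𝕜 L] [LieAlgebra 𝕜 L']

theorem adExpCoeff_zero_right (m : ℕ) (c : L) : adExpCoeff 𝕜 m c 0 = 1 := by
  simp [adExpCoeff]

theorem adExpCoeff_eq_zero {m i : ℕ} (c : L) (h0 : 0 < i) (h : i < m) :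
    adExpCoeff 𝕜 m c i = 0 :=
  if_neg fun hd => absurd (Nat.le_of_dvd h0 hd) (by omega)

theorem adExpCoeff_zero_left {m i : ℕ} (hm : 0 < m) (hi : 0 < i) :
    adExpCoeff 𝕜 m (0 : L) i = 0 := by
  unfold adExpCoeff
  split_ifs with h
  · have : i / m ≠ 0 := (Nat.div_pos (Nat.le_of_dvd hi h) hm).ne'
    simp [this]
  · rfl

/-- Since `exp (tᵐ ad c) = 1 + O(tᵐ)`, a series starting at `t^q` is first altered at `t^(q+m)`. -/
theorem conjCoeff_eq_self {m q n : ℕ} (c : L) {y : ℕ → L} (hy : ∀ j < q, y j = 0)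
    (h : n < q + m) : conjCoeff 𝕜 m c y n = y n := by
  unfold conjCoeff
  rw [Finset.sum_eq_single (0, n)]
  · simp [adExpCoeff_zero_right]
  · rintro ⟨i, j⟩ hij hne
    rw [mem_antidiagonal] at hij
    dsimp only at hij ⊢
    have hi : 0 < i := by
      rcases Nat.eq_zero_or_pos i with rfl | hi
      · exact absurd (by simpa using hij) (by simpa using hne)
      · exact hi
    by_cases him : i < m
    · rw [adExpCoeff_eq_zero c hi him, LinearMap.zero_apply]
    · rw [hy j (by omega), map_zero]
  · simp

theorem leftMulExp_zero {m : ℕ} (hm : 0 < m) (y : ℕ → L) : leftMulExp 𝕜 m 0 y = y := by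
  ext n
  unfold leftMulExp conjCoeff
  rw [Finset.sum_eq_single (0, n)]
  · simp [adExpCoeff_zero_right]
  · rintro ⟨i, j⟩ hij hne
    rw [mem_antidiagonal] at hij
    dsimp only at hij ⊢
    have hi : 0 < i := by
      rcases Nat.eq_zero_or_pos i with rfl | hi
      · exact absurd (by simpa using hij) (by simpa using hne)
      · exact hi
    rw [adExpCoeff_zero_left hm hi, LinearMap.zero_apply]
  · simp

theorem leftMulExp_one_zero (c : L) (y : ℕ → L) : leftMulExp 𝕜 1 c y 0 = y 0 + c := by
  simp [leftMulExp, conjCoeff, adExpCoeff_zero_right]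

theorem leftMulExp_one_one (c : L) (y : ℕ → L) :
    leftMulExp 𝕜 1 c y 1 = y 1 + ⁅c, y 0⁆ := by
  simp [leftMulExp, conjCoeff, Finset.Nat.antidiagonal_succ, adExpCoeff]

/-- Step `m + 1` conjugates a series starting at `tᵐ`, hence leaves the coefficients below `2m + 1`
alone; the added multiple of `c` then cancels exactly the coefficient of `tᵐ`. -/
theorem residualCoeff_eq_zero [CharZero 𝕜] (y : ℕ → L) {m n : ℕ} (h : n < m) :
    residualCoeff 𝕜 y m n = 0 := by
  induction m generalizing n with
  | zero => omega
  | succ m ih =>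
    have hm : ((m + 1 : ℕ) : 𝕜) ≠ 0 := Nat.cast_ne_zero.2 (Nat.succ_ne_zero m)
    rw [residualCoeff, leftMulExp, conjCoeff_eq_self (q := m) _ (fun j hj => ih hj) (by omega)]
    rcases Nat.lt_succ_iff_lt_or_eq.1 h with h | rfl
    · rw [if_neg (by omega), ih h, add_zero]
    · rw [if_pos rfl, smul_neg, smul_inv_smul₀ hm, add_neg_cancel]

theorem residualCoeff_eq_self {y : ℕ → L} {p : ℕ} (hy : ∀ n < p, y n = 0) {k : ℕ} (hk : k ≤ p) :
    residualCoeff 𝕜 y k = y := by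
  induction k with
  | zero => rfl
  | succ k ih =>
    rw [residualCoeff, ih (by omega), hy k (by omega), smul_zero, neg_zero, leftMulExp_zero k.succ_pos]

theorem zassenhausExponent_eq_zero {y : ℕ → L} {p : ℕ} (hy : ∀ n < p, y n = 0) {k : ℕ}
    (hk : k ≤ p) : zassenhausExponent 𝕜 y k = 0 := by
  cases k with
  | zero => rfl
  | succ k =>
    rw [zassenhausExponent, residualCoeff_eq_self hy (by omega), hy k (by omega), smul_zero]

/-! ### Compatibility with Lie algebra homomorphisms -/

section Map

variable (f : L →ₗ⁅𝕜⁆ L')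

theorem map_ad_pow (c y : L) (n : ℕ) :
    f ((LieAlgebra.ad 𝕜 L c ^ n) y) = (LieAlgebra.ad 𝕜 L' (f c) ^ n) (f y) := by
  induction n with
  | zero => simp
  | succ n ih => simp only [pow_succ', Module.End.mul_apply, LieAlgebra.ad_apply, LieHom.map_lie, ih]

theorem map_leftMulExp (m : ℕ) (c : L) (y : ℕ → L) (n : ℕ) :
    f (leftMulExp 𝕜 m c y n) = leftMulExp 𝕜 m (f c) (fun n => f (y n)) n := by
  have h (i : ℕ) (x : L) : f (adExpCoeff 𝕜 m c i x) = adExpCoeff 𝕜 m (f c) i (f x) := by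
    unfold adExpCoeff
    split_ifs
    · simp only [LinearMap.smul_apply, map_smul, map_ad_pow]
    · simp
  simp only [leftMulExp, conjCoeff, map_add, map_sum, h, apply_ite f, map_smul, map_zero]

theorem map_logDerivCoeff (l : List L) (n : ℕ) :
    f (logDerivCoeff 𝕜 l n) = logDerivCoeff 𝕜 (l.map f) n := by
  induction l generalizing n with
  | nil => simp [logDerivCoeff]
  | cons c l ih => simp only [logDerivCoeff, map_leftMulExp, ih, List.map_cons]

theorem map_residualCoeff (y : ℕ → L) (m n : ℕ) :
    f (residualCoeff 𝕜 y m n) = residualCoeff 𝕜 (fun n => f (y n)) m n := by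
  induction m generalizing n with
  | zero => rfl
  | succ m ih => simp only [residualCoeff, map_leftMulExp, ih, map_neg, map_smul]

theorem map_zassenhausExponent (y : ℕ → L) (k : ℕ) :
    f (zassenhausExponent 𝕜 y k) = zassenhausExponent 𝕜 (fun n => f (y n)) k := by
  cases k with
  | zero => simp [zassenhausExponent]
  | succ k => simp only [zassenhausExponent, map_smul, map_residualCoeff]

end Map

/-! ### Degrees in the free Lie algebra -/

section Homogeneous

theorem lie_mem_lieHomogeneous {k l : ℕ} {x y : FreeLieAlgebra 𝕜 (Fin 2)}
    (hx : x ∈ lieHomogeneous 𝕜 k) (hy : y ∈ lieHomogeneous 𝕜 l) :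
    ⁅x, y⁆ ∈ lieHomogeneous 𝕜 (k + l) := by
  unfold lieHomogeneous at hx hy
  induction hx using Submodule.span_induction with
  | mem x hx =>
    induction hy using Submodule.span_induction with
    | mem y hy => exact Submodule.subset_span (.lie hx hy)
    | zero => simp
    | add y z _ _ h₁ h₂ => rw [lie_add]; exact add_mem h₁ h₂
    | smul a y _ h => rw [lie_smul]; exact Submodule.smul_mem _ a h
  | zero => simp
  | add y z _ _ h₁ h₂ => rw [add_lie]; exact add_mem h₁ h₂
  | smul a y _ h => rw [smul_lie]; exact Submodule.smul_mem _ a h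

theorem ad_pow_mem_lieHomogeneous {k l : ℕ} {x y : FreeLieAlgebra 𝕜 (Fin 2)}
    (hx : x ∈ lieHomogeneous 𝕜 k) (hy : y ∈ lieHomogeneous 𝕜 l) (n : ℕ) :
    (LieAlgebra.ad 𝕜 _ x ^ n) y ∈ lieHomogeneous 𝕜 (k * n + l) := by
  induction n with
  | zero => simpa using hy
  | succ n ih =>
    rw [pow_succ', Module.End.mul_apply, LieAlgebra.ad_apply,
      show k * (n + 1) + l = k + (k * n + l) by ring]
    exact lie_mem_lieHomogeneous hx ih

/-- Each `tᵐ` comes with an element of degree `m`; the shift to `n + 1` is due to differentiation.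
-/
theorem leftMulExp_mem_lieHomogeneous {m : ℕ} {c : FreeLieAlgebra 𝕜 (Fin 2)}
    {y : ℕ → FreeLieAlgebra 𝕜 (Fin 2)} (hc : c ∈ lieHomogeneous 𝕜 m)
    (hy : ∀ n, y n ∈ lieHomogeneous 𝕜 (n + 1)) (n : ℕ) :
    leftMulExp 𝕜 m c y n ∈ lieHomogeneous 𝕜 (n + 1) := by
  refine add_mem (sum_mem fun ij hij => ?_) ?_
  · rw [mem_antidiagonal] at hij
    unfold adExpCoeff
    split_ifs with h
    · have := ad_pow_mem_lieHomogeneous hc (hy ij.2) (ij.1 / m)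
      rw [Nat.mul_div_cancel' h, ← add_assoc, hij] at this
      exact Submodule.smul_mem _ _ this
    · simp
  · split_ifs with h
    · subst h
      exact Submodule.smul_mem _ _ hc
    · exact zero_mem _

theorem logDerivCoeff_mem_lieHomogeneous {l : List (FreeLieAlgebra 𝕜 (Fin 2))}
    (hl : ∀ c ∈ l, c ∈ lieHomogeneous 𝕜 1) (n : ℕ) :
    logDerivCoeff 𝕜 l n ∈ lieHomogeneous 𝕜 (n + 1) := by
  induction l generalizing n with
  | nil => exact zero_mem _
  | cons c l ih =>
    exact leftMulExp_mem_lieHomogeneous (hl c (by simp))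
      (fun n => ih (fun c hc => hl c (by simp [hc])) n) n

theorem residualCoeff_mem_lieHomogeneous {y : ℕ → FreeLieAlgebra 𝕜 (Fin 2)}
    (hy : ∀ n, y n ∈ lieHomogeneous 𝕜 (n + 1)) (m n : ℕ) :
    residualCoeff 𝕜 y m n ∈ lieHomogeneous 𝕜 (n + 1) := by
  induction m generalizing n with
  | zero => exact hy n
  | succ m ih =>
    exact leftMulExp_mem_lieHomogeneous (neg_mem (Submodule.smul_mem _ _ (ih m))) ih n

theorem zassenhausExponent_mem_lieHomogeneous {y : ℕ → FreeLieAlgebra 𝕜 (Fin 2)}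
    (hy : ∀ n, y n ∈ lieHomogeneous 𝕜 (n + 1)) (k : ℕ) :
    zassenhausExponent 𝕜 y k ∈ lieHomogeneous 𝕜 k := by
  cases k with
  | zero => exact zero_mem _
  | succ k => exact Submodule.smul_mem _ _ (residualCoeff_mem_lieHomogeneous hy k k)

end Homogeneous

end LieSeries

/-! ### Rearranging sums -/

section Summation

open Finset.HasAntidiagonal

theorem HasSum.sum_antidiagonal {E : Type*} [AddCommMonoid E] [TopologicalSpace E]
    [ContinuousAdd E] [RegularSpace E] {f : ℕ × ℕ → E} {a : E} (h : HasSum f a) :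
    HasSum (fun n => ∑ ij ∈ antidiagonal n, f ij) a := by
  refine ((sigmaAntidiagonalEquivProd (A := ℕ)).hasSum_iff.2 h).sigma fun n => ?_
  rw [← Finset.sum_finset_coe]
  exact hasSum_fintype _

theorem HasSum.extend_dvd {E : Type*} [AddCommMonoid E] [TopologicalSpace E] {f : ℕ → E} {a : E}
    (h : HasSum f a) {m : ℕ} (hm : 0 < m) :
    HasSum (fun i => if m ∣ i then f (i / m) else 0) a := by
  have hinj : Function.Injective fun k : ℕ => m * k := fun a b h => Nat.eq_of_mul_eq_mul_left hm h
  refine (hinj.hasSum_iff ?_).1 ?_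
  · intro i hi
    exact if_neg fun ⟨k, hk⟩ => hi ⟨k, hk.symm⟩
  · have : (fun i => if m ∣ i then f (i / m) else 0) ∘ (fun k => m * k) = f := by
      ext k
      simp [hm]
    rwa [this]

end Summation

/-! ### Logarithmic derivatives in a Banach algebra -/

section LogDeriv

open Finset.HasAntidiagonal
open scoped Nat

attribute [local instance] LieRing.ofAssociativeRing

variable {𝕜 : Type*} [RCLike 𝕜] {𝔸 : Type*} [NormedRing 𝔸] [NormedAlgebra 𝕜 𝔸]

theorem norm_lie_le_two_mul (c y : 𝔸) : ‖⁅c, y⁆‖ ≤ 2 * ‖c‖ * ‖y‖ := by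
  rw [Ring.lie_def]
  calc ‖c * y - y * c‖ ≤ ‖c‖ * ‖y‖ + ‖y‖ * ‖c‖ :=
        (norm_sub_le _ _).trans (add_le_add (norm_mul_le _ _) (norm_mul_le _ _))
    _ = 2 * ‖c‖ * ‖y‖ := by ring

theorem norm_ad_pow_le (c y : 𝔸) (n : ℕ) :
    ‖(LieAlgebra.ad 𝕜 𝔸 c ^ n) y‖ ≤ (2 * ‖c‖) ^ n * ‖y‖ := by
  induction n with
  | zero => simp
  | succ n ih =>
    rw [pow_succ', Module.End.mul_apply, LieAlgebra.ad_apply]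
    calc _ ≤ 2 * ‖c‖ * ((2 * ‖c‖) ^ n * ‖y‖) :=
          (norm_lie_le_two_mul _ _).trans (by gcongr)
      _ = _ := by ring

/-- The coefficient of `t ^ i` in the power series `exp (x t ^ m)`. -/
noncomputable def expPowCoeff (m : ℕ) (x : ℝ) (i : ℕ) : ℝ :=
  if m ∣ i then ((i / m)! : ℝ)⁻¹ * x ^ (i / m) else 0

theorem expPowCoeff_nonneg (m : ℕ) {x : ℝ} (hx : 0 ≤ x) (i : ℕ) : 0 ≤ expPowCoeff m x i := by
  unfold expPowCoeff
  split_ifs <;> positivity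

theorem hasSum_expPowCoeff {m : ℕ} (hm : 0 < m) (x r : ℝ) :
    HasSum (fun i => expPowCoeff m x i * r ^ i) (Real.exp (x * r ^ m)) := by
  have h := NormedSpace.exp_series_hasSum_exp' (𝕂 := ℝ) (x * r ^ m)
  rw [← Real.exp_eq_exp_ℝ] at h
  have e : (fun i => expPowCoeff m x i * r ^ i) =
      fun i => if m ∣ i then ((i / m)! : ℝ)⁻¹ • (x * r ^ m) ^ (i / m) else 0 := by
    ext i
    unfold expPowCoeff
    split_ifs with hd
    · rw [smul_eq_mul, mul_pow, ← pow_mul, Nat.mul_div_cancel' hd, mul_assoc]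
    · simp
  rw [e]
  exact h.extend_dvd hm

theorem norm_adExpCoeff_le (m : ℕ) (c y : 𝔸) (i : ℕ) :
    ‖adExpCoeff 𝕜 m c i y‖ ≤ expPowCoeff m (2 * ‖c‖) i * ‖y‖ := by
  unfold adExpCoeff expPowCoeff
  split_ifs
  · rw [LinearMap.smul_apply, norm_smul, norm_inv, RCLike.norm_natCast, mul_assoc]
    gcongr
    exact norm_ad_pow_le _ _ _
  · simp

/-- The terms of a series that dominates the power series with coefficients `conjCoeff`. -/
noncomputable def conjBound (m : ℕ) (c : 𝔸) (y : ℕ → 𝔸) (r : ℝ) (n : ℕ) : ℝ :=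
  ∑ ij ∈ antidiagonal n, expPowCoeff m (2 * ‖c‖) ij.1 * r ^ ij.1 * (‖y ij.2‖ * r ^ ij.2)

theorem norm_conjCoeff_mul_pow_le (m : ℕ) (c : 𝔸) (y : ℕ → 𝔸) {r : ℝ} (hr : 0 ≤ r) (n : ℕ) :
    ‖conjCoeff 𝕜 m c y n‖ * r ^ n ≤ conjBound m c y r n := by
  unfold conjCoeff conjBound
  refine (mul_le_mul_of_nonneg_right (norm_sum_le _ _) (pow_nonneg hr n)).trans ?_
  rw [Finset.sum_mul]
  refine Finset.sum_le_sum fun ij hij => ?_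
  rw [mem_antidiagonal] at hij
  rw [← hij, pow_add]
  calc _ ≤ expPowCoeff m (2 * ‖c‖) ij.1 * ‖y ij.2‖ * (r ^ ij.1 * r ^ ij.2) := by
        gcongr
        exact norm_adExpCoeff_le _ _ _ _
    _ = _ := by ring

theorem summable_expPowCoeff_mul {m : ℕ} (hm : 0 < m) (c : 𝔸) {y : ℕ → 𝔸} {r : ℝ} (hr : 0 ≤ r)
    (hy : Summable fun n => ‖y n‖ * r ^ n) :
    Summable fun ij : ℕ × ℕ =>
      expPowCoeff m (2 * ‖c‖) ij.1 * r ^ ij.1 * (‖y ij.2‖ * r ^ ij.2) :=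
  (hasSum_expPowCoeff hm (2 * ‖c‖) r).summable.mul_of_nonneg hy
    (fun i => mul_nonneg (expPowCoeff_nonneg m (by positivity) i) (pow_nonneg hr i))
    (fun j => by positivity)

theorem hasSum_conjBound {m : ℕ} (hm : 0 < m) (c : 𝔸) {y : ℕ → 𝔸} {r : ℝ} (hr : 0 ≤ r)
    (hy : Summable fun n => ‖y n‖ * r ^ n) :
    HasSum (conjBound m c y r) (Real.exp (2 * ‖c‖ * r ^ m) * ∑' n, ‖y n‖ * r ^ n) :=
  ((hasSum_expPowCoeff hm (2 * ‖c‖) r).mul hy.hasSum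
    (summable_expPowCoeff_mul hm c hr hy)).sum_antidiagonal

theorem summable_leftMulExp {m : ℕ} (hm : 0 < m) (c : 𝔸) {y : ℕ → 𝔸} {r : ℝ} (hr : 0 ≤ r)
    (hy : Summable fun n => ‖y n‖ * r ^ n) :
    Summable fun n => ‖leftMulExp 𝕜 m c y n‖ * r ^ n := by
  have h : Summable fun n => ‖if n + 1 = m then (m : 𝕜) • c else 0‖ * r ^ n :=
    summable_of_ne_finset_zero (s := {m - 1}) fun n hn => by
      rw [if_neg (by simp at hn; omega), norm_zero, zero_mul]
  refine Summable.of_nonneg_of_le (fun n => by positivity) (fun n => ?_)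
    ((hasSum_conjBound hm c hr hy).summable.add h)
  calc _ ≤ (‖conjCoeff 𝕜 m c y n‖ + ‖if n + 1 = m then (m : 𝕜) • c else 0‖) * r ^ n := by
        gcongr
        exact norm_add_le _ _
    _ ≤ _ := by
        rw [add_mul]
        gcongr
        exact norm_conjCoeff_mul_pow_le m c y hr n

/-- `R 0 = 1`, and the logarithmic derivative `R' R⁻¹` is given by an everywhere convergent power
series with coefficients `y`. -/
structure IsLogDeriv (y : ℕ → 𝔸) (R : 𝕜 → 𝔸) : Prop where
  summable : ∀ r : ℝ, 0 ≤ r → Summable fun n => ‖y n‖ * r ^ n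
  map_zero : R 0 = 1
  hasDerivAt : ∀ t, HasDerivAt R ((∑' n, t ^ n • y n) * R t) t

theorem isLogDeriv_zero : IsLogDeriv (𝕜 := 𝕜) (0 : ℕ → 𝔸) fun _ => 1 where
  summable r _ := by simp
  map_zero := rfl
  hasDerivAt t := by simpa using hasDerivAt_const t (1 : 𝔸)

variable [CompleteSpace 𝔸]

-- Hadamard's formula: `ad c` is left multiplication by `c` plus right multiplication by `-c`. These
-- commute, so its exponential factors, and the exponential of a multiplication operator is
-- multiplication by the exponential.
variable (𝕜) in
theorem hasSum_ad_pow (c y : 𝔸) :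
    HasSum (fun n => ((n ! : 𝕜)⁻¹) • (LieAlgebra.ad 𝕜 𝔸 c ^ n) y)
      (NormedSpace.exp c * y * NormedSpace.exp (-c)) := by
  let l : 𝔸 →L[𝕜] 𝔸 →L[𝕜] 𝔸 := ContinuousLinearMap.mul 𝕜 𝔸
  let r : 𝔸 →L[𝕜] 𝔸 →L[𝕜] 𝔸 := (ContinuousLinearMap.mul 𝕜 𝔸).flip
  have hlpow (c y : 𝔸) (n : ℕ) : (l c ^ n) y = c ^ n * y := by
    induction n with
    | zero => simp
    | succ n ih => rw [pow_succ', mul_apply_eq_comp, ih, pow_succ', mul_assoc]; rfl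
  have hrpow (c y : 𝔸) (n : ℕ) : (r c ^ n) y = y * c ^ n := by
    induction n with
    | zero => simp
    | succ n ih => rw [pow_succ', mul_apply_eq_comp, ih, pow_succ, ← mul_assoc]; rfl
  have hsum (T : 𝔸 →L[𝕜] 𝔸) (y : 𝔸) :
      HasSum (fun n => ((n ! : 𝕜)⁻¹) • (T ^ n) y) (NormedSpace.exp T y) :=
    (NormedSpace.exp_series_hasSum_exp' (𝕂 := 𝕜) T).mapL (ContinuousLinearMap.apply 𝕜 𝔸 y)
  have hl (c y : 𝔸) : NormedSpace.exp (l c) y = NormedSpace.exp c * y := by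
    refine (hsum (l c) y).unique ?_
    simp only [hlpow, ← smul_mul_assoc]
    exact (NormedSpace.exp_series_hasSum_exp' (𝕂 := 𝕜) c).mul_right y
  have hr (c y : 𝔸) : NormedSpace.exp (r c) y = y * NormedSpace.exp c := by
    refine (hsum (r c) y).unique ?_
    simp only [hrpow, ← mul_smul_comm]
    exact (NormedSpace.exp_series_hasSum_exp' (𝕂 := 𝕜) c).mul_left y
  have hcomm : Commute (l c) (r (-c)) := by
    ext y
    change c * (y * -c) = c * y * -c
    rw [mul_assoc]
  have had (n : ℕ) : (LieAlgebra.ad 𝕜 𝔸 c ^ n) y = ((l c + r (-c)) ^ n) y := by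
    induction n with
    | zero => simp
    | succ n ih =>
      rw [pow_succ', pow_succ', Module.End.mul_apply, ih, mul_apply_eq_comp,
        LieAlgebra.ad_apply, Ring.lie_def]
      change _ = c * _ + _ * -c
      rw [mul_neg, sub_eq_add_neg]
  simp only [had]
  convert hsum (l c + r (-c)) y using 1
  let _ : NormedAlgebra ℚ (𝔸 →L[𝕜] 𝔸) := .restrictScalars ℚ 𝕜 _
  rw [NormedSpace.exp_add_of_commute hcomm, mul_apply_eq_comp, hl, hr, mul_assoc]

theorem hasSum_adExpCoeff {m : ℕ} (hm : 0 < m) (c y : 𝔸) (t : 𝕜) :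
    HasSum (fun i => t ^ i • adExpCoeff 𝕜 m c i y)
      (NormedSpace.exp (t ^ m • c) * y * NormedSpace.exp (-(t ^ m • c))) := by
  convert (hasSum_ad_pow 𝕜 (t ^ m • c) y).extend_dvd hm using 2 with i
  unfold adExpCoeff
  split_ifs with hd
  · rw [map_smul, smul_pow, ← pow_mul, Nat.mul_div_cancel' hd, LinearMap.smul_apply,
      LinearMap.smul_apply, smul_comm]
  · simp

theorem hasSum_conjCoeff {m : ℕ} (hm : 0 < m) (c : 𝔸) {y : ℕ → 𝔸} {t : 𝕜}
    (hy : Summable fun n => ‖y n‖ * ‖t‖ ^ n) :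
    HasSum (fun n => t ^ n • conjCoeff 𝕜 m c y n)
      (NormedSpace.exp (t ^ m • c) * (∑' n, t ^ n • y n) * NormedSpace.exp (-(t ^ m • c))) := by
  let g : ℕ × ℕ → 𝔸 := fun ij => t ^ ij.1 • adExpCoeff 𝕜 m c ij.1 (t ^ ij.2 • y ij.2)
  have hg : Summable g := by
    refine Summable.of_norm_bounded (summable_expPowCoeff_mul hm c (norm_nonneg t) hy)
      fun ij => ?_
    simp only [g]
    rw [norm_smul, norm_pow]
    calc _ ≤ ‖t‖ ^ ij.1 * (expPowCoeff m (2 * ‖c‖) ij.1 * ‖t ^ ij.2 • y ij.2‖) := by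
          gcongr
          exact norm_adExpCoeff_le _ _ _ _
      _ = _ := by rw [norm_smul, norm_pow]; ring
  have hy' : Summable fun n => t ^ n • y n :=
    Summable.of_norm_bounded hy fun n => by rw [norm_smul, norm_pow, mul_comm]
  have hval : HasSum g (NormedSpace.exp (t ^ m • c) * (∑' n, t ^ n • y n) *
      NormedSpace.exp (-(t ^ m • c))) := by
    -- Summing over the first index gives the conjugate of `t ^ j • y j`; conjugation is linear and
    -- continuous, so the sum over `j` is the conjugate of the whole series.
    have h₁ := ((Equiv.prodComm ℕ ℕ).hasSum_iff.2 hg.hasSum).prod_fiberwise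
      fun j => hasSum_adExpCoeff hm c (t ^ j • y j) t
    rw [← h₁.unique ((hy'.hasSum.mul_left _).mul_right _)]
    exact hg.hasSum
  convert hval.sum_antidiagonal using 2 with n
  rw [conjCoeff, Finset.smul_sum]
  refine Finset.sum_congr rfl fun ij hij => ?_
  rw [mem_antidiagonal] at hij
  simp only [g]
  rw [map_smul, smul_smul, ← pow_add, hij]

theorem tsum_leftMulExp {m : ℕ} (hm : 0 < m) (c : 𝔸) {y : ℕ → 𝔸} {t : 𝕜}
    (hy : Summable fun n => ‖y n‖ * ‖t‖ ^ n) :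
    ∑' n, t ^ n • leftMulExp 𝕜 m c y n =
      NormedSpace.exp (t ^ m • c) * (∑' n, t ^ n • y n) * NormedSpace.exp (-(t ^ m • c)) +
        (m * t ^ (m - 1)) • c := by
  have h : HasSum (fun n => t ^ n • if n + 1 = m then (m : 𝕜) • c else 0)
      ((m * t ^ (m - 1)) • c) := by
    convert hasSum_single (m - 1) ?_ using 1
    · rw [if_pos (by omega), smul_smul, mul_comm]
    · intro n hn
      rw [if_neg (by omega), smul_zero]
  rw [← ((hasSum_conjCoeff hm c hy).add h).tsum_eq]
  simp only [leftMulExp, smul_add]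

theorem exp_neg_mul_exp_self (𝕜 : Type*) [RCLike 𝕜] [NormedAlgebra 𝕜 𝔸] (c : 𝔸) :
    NormedSpace.exp (-c) * NormedSpace.exp c = 1 := by
  let _ : NormedAlgebra ℚ 𝔸 := .restrictScalars ℚ 𝕜 _
  rw [← NormedSpace.exp_add_of_commute (Commute.refl c).neg_left, neg_add_cancel,
    NormedSpace.exp_zero]

theorem exp_mul_exp_neg_self (𝕜 : Type*) [RCLike 𝕜] [NormedAlgebra 𝕜 𝔸] (c : 𝔸) :
    NormedSpace.exp c * NormedSpace.exp (-c) = 1 := by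
  simpa using exp_neg_mul_exp_self 𝕜 (-c)

/-- With `E = exp (tᵐ c)` and `R' = Y R`, the product rule gives `(E R)' = (m tᵐ⁻¹ c + E Y E⁻¹) E
R`. -/
theorem IsLogDeriv.exp_mul {y : ℕ → 𝔸} {R : 𝕜 → 𝔸} (h : IsLogDeriv y R) {m : ℕ} (hm : 0 < m)
    (c : 𝔸) :
    IsLogDeriv (leftMulExp 𝕜 m c y) fun t => NormedSpace.exp (t ^ m • c) * R t where
  summable r hr := summable_leftMulExp hm c hr (h.summable r hr)
  map_zero := by rw [zero_pow hm.ne', zero_smul, NormedSpace.exp_zero, h.map_zero, one_mul]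
  hasDerivAt t := by
    have h₁ : HasDerivAt (fun t : 𝕜 => NormedSpace.exp (t ^ m • c))
        ((m * t ^ (m - 1)) • (c * NormedSpace.exp (t ^ m • c))) t :=
      (hasDerivAt_exp_smul_const' c (t ^ m)).scomp t (hasDerivAt_pow m t)
    refine (h₁.mul (h.hasDerivAt t)).congr_deriv ?_
    rw [tsum_leftMulExp hm c (h.summable _ (norm_nonneg t)), add_mul, add_comm, smul_mul_assoc,
      smul_mul_assoc, ← mul_assoc c]
    congr 1
    rw [mul_assoc _ (NormedSpace.exp (-(t ^ m • c))) (_ * _),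
      ← mul_assoc (NormedSpace.exp (-(t ^ m • c))),
      exp_neg_mul_exp_self 𝕜, one_mul, mul_assoc]

end LogDeriv

/-! ### Remainder estimates and convergence -/

section Estimates

open scoped Nat

attribute [local instance] LieRing.ofAssociativeRing

variable {𝕜 : Type*} [RCLike 𝕜] {𝔸 : Type*} [NormedRing 𝔸] [NormedAlgebra 𝕜 𝔸]

theorem norm_tsum_pow_smul_le {y : ℕ → 𝔸} {q : ℕ} (hy : ∀ n < q, y n = 0) {r N : ℝ} (hr : 0 < r)
    (hs : Summable fun n => ‖y n‖ * r ^ n) (hN : ∑' n, ‖y n‖ * r ^ n ≤ N) {z : 𝕜}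
    (hz : ‖z‖ ≤ r) : ‖∑' n, z ^ n • y n‖ ≤ (‖z‖ / r) ^ q * N := by
  have hle (n : ℕ) : ‖z ^ n • y n‖ ≤ (‖z‖ / r) ^ q * (‖y n‖ * r ^ n) := by
    rcases lt_or_ge n q with h | h
    · simp [hy n h]
    · rw [norm_smul, norm_pow]
      have h₁ : ‖z‖ ^ n = (‖z‖ / r) ^ n * r ^ n := by rw [div_pow, div_mul_cancel₀ _ (by positivity)]
      have h₂ : (‖z‖ / r) ^ n ≤ (‖z‖ / r) ^ q :=
        pow_le_pow_of_le_one (by positivity) ((div_le_one hr).2 hz) h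
      rw [h₁]
      calc _ ≤ (‖z‖ / r) ^ q * r ^ n * ‖y n‖ := by gcongr
        _ = _ := by ring
  refine (tsum_of_norm_bounded (hs.mul_left _).hasSum hle).trans ?_
  rw [tsum_mul_left]
  gcongr

/-- Grönwall's inequality for `s ↦ R (s t) - 1` on `[0, 1]`, which treats real and complex `t`
alike. The factor `‖1‖` stays because the algebra may be trivial. -/
theorem IsLogDeriv.norm_sub_one_le {y : ℕ → 𝔸} {R : 𝕜 → 𝔸} (h : IsLogDeriv y R) {q : ℕ}
    (hy : ∀ n < q, y n = 0) {r N : ℝ} (hr : 0 < r) (hN : ∑' n, ‖y n‖ * r ^ n ≤ N) {t : 𝕜}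
    (ht : ‖t‖ ≤ r) :
    ‖R t - 1‖ ≤ ‖t‖ * (‖t‖ / r) ^ q * (N * ‖(1 : 𝔸)‖ * Real.exp (r * N + 1)) := by
  let _ : NormedAlgebra ℝ 𝔸 := .restrictScalars ℝ 𝕜 𝔸
  have : IsScalarTower ℝ 𝕜 𝔸 := ⟨fun x y z => by
    rw [RCLike.real_smul_eq_coe_mul, mul_smul]; rfl⟩
  have hN0 : 0 ≤ N := (tsum_nonneg fun n => by positivity).trans hN
  set ε : ℝ := ‖t‖ * (‖t‖ / r) ^ q * N * ‖(1 : 𝔸)‖ with hε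
  have hε0 : 0 ≤ ε := by positivity
  -- The summand `1` makes `K ≥ 1`, so the division by `K` in the Grönwall bound is harmless.
  set K : ℝ := r * N + 1
  have hK : 1 ≤ K := le_add_of_nonneg_left (by positivity)
  have hder (s : ℝ) : HasDerivAt (fun s : ℝ => R ((s : 𝕜) * t) - 1)
      (t • ((∑' n, ((s : 𝕜) * t) ^ n • y n) * R ((s : 𝕜) * t))) s := by
    have hg : HasDerivAt (fun s : ℝ => (s : 𝕜) * t) t s := by
      simpa using (RCLike.ofRealCLM (K := 𝕜)).hasDerivAt.mul_const t
    exact ((h.hasDerivAt ((s : 𝕜) * t)).scomp s hg).sub_const 1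
  have hbound (s : ℝ) (hs : s ∈ Set.Ico (0 : ℝ) 1) :
      ‖t • ((∑' n, ((s : 𝕜) * t) ^ n • y n) * R ((s : 𝕜) * t))‖ ≤
        K * ‖R ((s : 𝕜) * t) - 1‖ + ε := by
    have hst : ‖(s : 𝕜) * t‖ ≤ ‖t‖ := by
      rw [norm_mul, RCLike.norm_ofReal, abs_of_nonneg hs.1]
      exact mul_le_of_le_one_left (norm_nonneg t) hs.2.le
    have h₁ : ‖∑' n, ((s : 𝕜) * t) ^ n • y n‖ ≤ (‖t‖ / r) ^ q * N :=
      (norm_tsum_pow_smul_le hy hr (h.summable r hr.le) hN (hst.trans ht)).trans (by gcongr)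
    have h₂ : ‖R ((s : 𝕜) * t)‖ ≤ ‖R ((s : 𝕜) * t) - 1‖ + ‖(1 : 𝔸)‖ := by
      simpa using norm_add_le (R ((s : 𝕜) * t) - 1) 1
    have h₃ : ‖t‖ * ((‖t‖ / r) ^ q * N) ≤ K := by
      have : (‖t‖ / r) ^ q ≤ 1 := pow_le_one₀ (by positivity) ((div_le_one hr).2 ht)
      calc _ ≤ r * (1 * N) := by gcongr
        _ ≤ K := by simp [K]
    rw [norm_smul]
    calc _ ≤ ‖t‖ * ((‖t‖ / r) ^ q * N * (‖R ((s : 𝕜) * t) - 1‖ + ‖(1 : 𝔸)‖)) := by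
          gcongr
          exact (norm_mul_le _ _).trans (by gcongr)
      _ = ‖t‖ * ((‖t‖ / r) ^ q * N) * ‖R ((s : 𝕜) * t) - 1‖ + ε := by rw [hε]; ring
      _ ≤ _ := by gcongr
  have := norm_le_gronwallBound_of_norm_deriv_right_le (δ := 0) (K := K) (ε := ε)
    (fun s _ => (hder s).continuousAt.continuousWithinAt) (fun s _ => (hder s).hasDerivWithinAt)
    (by simp [h.map_zero]) hbound 1 (by simp)
  rw [gronwallBound_of_K_ne_0 (by positivity)] at this
  simp only [RCLike.ofReal_one, one_mul, sub_zero, mul_one, zero_mul, zero_add] at this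
  calc _ ≤ ε / K * (Real.exp K - 1) := this
    _ ≤ ε / 1 * Real.exp K := by
        gcongr
        · exact sub_nonneg.2 (Real.one_le_exp (by positivity))
        · linarith
    _ = _ := by rw [hε]; ring

theorem IsLogDeriv.sub_one_isBigO {y : ℕ → 𝔸} {R : 𝕜 → 𝔸} (h : IsLogDeriv y R) {q : ℕ}
    (hy : ∀ n < q, y n = 0) :
    (fun t : ℝ => R (t : 𝕜) - 1) =O[𝓝 0] fun t : ℝ => t ^ (q + 1) := by
  refine IsBigO.of_bound ((∑' n, ‖y n‖ * 1 ^ n) * ‖(1 : 𝔸)‖ *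
    Real.exp (1 * (∑' n, ‖y n‖ * 1 ^ n) + 1)) ?_
  filter_upwards [Metric.closedBall_mem_nhds (0 : ℝ) one_pos] with t ht
  rw [mem_closedBall_zero_iff] at ht
  have := h.norm_sub_one_le hy one_pos le_rfl (t := (t : 𝕜)) (by rwa [RCLike.norm_ofReal])
  rw [RCLike.norm_ofReal, div_one, ← pow_succ', mul_comm] at this
  rwa [norm_pow]

/-- Cancelling the leading coefficient saves `d = ‖z m‖ rᵐ`, while conjugation costs a factor at
most `exp (2 r d) ≤ 1 + 4 r d`. The norm `u` thus changes by at most `d (4 r u - 1) ≤ 0`. -/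
theorem tsum_residualCoeff_le {y : ℕ → 𝔸} {r U : ℝ} (hr : 0 < r) (hrU : 4 * (r * U) ≤ 1)
    (hs : Summable fun n => ‖y n‖ * r ^ n) (hU : ∑' n, ‖y n‖ * r ^ n ≤ U) (m : ℕ) :
    (Summable fun n => ‖residualCoeff 𝕜 y m n‖ * r ^ n) ∧
      ∑' n, ‖residualCoeff 𝕜 y m n‖ * r ^ n ≤ U := by
  induction m with
  | zero => exact ⟨hs, hU⟩
  | succ m ih =>
    obtain ⟨ihs, ihU⟩ := ih
    set z := residualCoeff 𝕜 y m with hz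
    have hz0 : ∀ n < m, z n = 0 := fun n hn => residualCoeff_eq_zero y hn
    set c : 𝔸 := -(((m + 1 : ℕ) : 𝕜)⁻¹ • z m) with hc
    have hres : residualCoeff 𝕜 y (m + 1) = leftMulExp 𝕜 (m + 1) c z := rfl
    set d : ℝ := ‖z m‖ * r ^ m with hd
    have hd0 : 0 ≤ d := by positivity
    set u := ∑' n, ‖z n‖ * r ^ n
    have hdu : d ≤ u := ihs.le_tsum m fun n _ => by positivity
    have hcd : 2 * ‖c‖ * r ^ (m + 1) ≤ 2 * (r * d) := by
      have : ‖c‖ ≤ ‖z m‖ := by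
        rw [hc, norm_neg, norm_smul, norm_inv, RCLike.norm_natCast]
        exact mul_le_of_le_one_left (norm_nonneg _)
          (inv_le_one_of_one_le₀ (by exact_mod_cast Nat.succ_pos m))
      calc _ ≤ 2 * ‖z m‖ * r ^ (m + 1) := by gcongr
        _ = _ := by rw [hd]; ring
    have hrd : r * d ≤ r * U := by gcongr; exact hdu.trans ihU
    have hexp : Real.exp (2 * ‖c‖ * r ^ (m + 1)) ≤ 1 + 4 * (r * d) := by
      have h₁ := Real.abs_exp_sub_one_le (x := 2 * (r * d))
        (by rw [abs_of_nonneg (by positivity)]; linarith)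
      rw [abs_of_nonneg (a := 2 * (r * d)) (by positivity)] at h₁
      linarith [le_abs_self (Real.exp (2 * (r * d)) - 1), Real.exp_le_exp.2 hcd]
    have hle (n : ℕ) : ‖residualCoeff 𝕜 y (m + 1) n‖ * r ^ n ≤
        conjBound (m + 1) c z r n - if n = m then d else 0 := by
      have h := norm_conjCoeff_mul_pow_le (𝕜 := 𝕜) (m + 1) c z hr.le n
      rcases lt_trichotomy n m with hn | rfl | hn
      · rw [residualCoeff_eq_zero y (by omega), norm_zero, zero_mul, if_neg hn.ne, sub_zero]
        exact le_trans (by positivity) h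
      · rw [residualCoeff_eq_zero y (by omega), norm_zero, zero_mul, if_pos rfl, sub_nonneg]
        rwa [conjCoeff_eq_self (q := n) c hz0 (by omega)] at h
      · rw [hres, leftMulExp, if_neg (by omega), add_zero, if_neg hn.ne', sub_zero]
        exact h
    have hsum := (hasSum_conjBound m.succ_pos c hr.le ihs).sub (hasSum_ite_eq m d)
    refine ⟨Summable.of_nonneg_of_le (fun n => by positivity) hle hsum.summable, ?_⟩
    refine (hasSum_le hle (Summable.of_nonneg_of_le (fun n => by positivity) hle
      hsum.summable).hasSum hsum).trans ?_
    have hu0 : 0 ≤ u := hd0.trans hdu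
    have hru : r * u ≤ r * U := by gcongr
    calc _ ≤ (1 + 4 * (r * d)) * u - d := by gcongr
      _ = u + d * (4 * (r * u) - 1) := by ring
      _ ≤ U := by nlinarith

/-- The ordered product `exp (t ^ q • c_q) ⋯ exp (t ^ m • c_m)`. -/
noncomputable def expProd (c : ℕ → 𝔸) (q m : ℕ) (t : 𝕜) : 𝔸 :=
  ((List.range' q (m + 1 - q)).map fun k => NormedSpace.exp (t ^ k • c k)).prod

theorem expProd_one_succ (c : ℕ → 𝔸) (m : ℕ) (t : 𝕜) :
    expProd c 1 (m + 1) t = expProd c 1 m t * NormedSpace.exp (t ^ (m + 1) • c (m + 1)) := by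
  simp [expProd, List.range'_concat, add_comm]

theorem expProd_eq_of_eq_zero {c : ℕ → 𝔸} {p : ℕ} (hc : ∀ k ≤ p, c k = 0) (m : ℕ) (t : 𝕜) :
    expProd c (p + 1) m t = expProd c 1 m t := by
  have h1 (q n : ℕ) (hq : q + n ≤ p + 1) :
      ((List.range' q n).map fun k => NormedSpace.exp (t ^ k • c k)).prod = 1 := by
    refine List.prod_eq_one fun x hx => ?_
    obtain ⟨k, hk, rfl⟩ := List.mem_map.1 hx
    rw [List.mem_range'_1] at hk
    rw [hc k (by omega), smul_zero, NormedSpace.exp_zero]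
  unfold expProd
  rcases le_or_gt m p with h | h
  · rw [h1 1 _ (by omega), show m + 1 - (p + 1) = 0 by omega]
    rfl
  · have : List.range' 1 (m + 1 - 1) = List.range' 1 p ++ List.range' (p + 1) (m + 1 - (p + 1)) := by
      rw [show p + 1 = 1 + 1 * p by omega, List.range'_append]
      congr 1
      omega
    rw [this, List.map_append, List.prod_append, h1 1 p (by omega), one_mul]

variable [CompleteSpace 𝔸]

theorem continuous_exp_pow_smul (𝕜 : Type*) [RCLike 𝕜] [NormedAlgebra 𝕜 𝔸] (k : ℕ) (c : 𝔸) :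
    Continuous fun t : 𝕜 => NormedSpace.exp (t ^ k • c) := by
  let _ : NormedAlgebra ℚ 𝔸 := .restrictScalars ℚ 𝕜 _
  exact NormedSpace.exp_continuous.comp (by fun_prop)

theorem continuous_expProd (c : ℕ → 𝔸) (m : ℕ) : Continuous fun t : 𝕜 => expProd c 1 m t := by
  induction m with
  | zero => simpa [expProd] using continuous_const
  | succ m ih =>
    simp only [expProd_one_succ]
    exact ih.mul (continuous_exp_pow_smul 𝕜 _ _)

/-- The recursion for `residualCoeff` is realised by `Q = exp (-C_m tᵐ) ⋯ exp (-C_1 t) R`. -/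
theorem IsLogDeriv.exists_residual {y : ℕ → 𝔸} {R : 𝕜 → 𝔸} (h : IsLogDeriv y R) (m : ℕ) :
    ∃ Q : 𝕜 → 𝔸, IsLogDeriv (residualCoeff 𝕜 y m) Q ∧
      ∀ t, R t = expProd (zassenhausExponent 𝕜 y) 1 m t * Q t := by
  induction m with
  | zero => exact ⟨R, h, fun t => by simp [expProd]⟩
  | succ m ih =>
    obtain ⟨Q, hQ, hR⟩ := ih
    refine ⟨_, hQ.exp_mul m.succ_pos (-zassenhausExponent 𝕜 y (m + 1)), fun t => ?_⟩
    rw [hR, expProd_one_succ, mul_assoc, ← mul_assoc (NormedSpace.exp _) (NormedSpace.exp _) (Q t),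
      smul_neg, exp_mul_exp_neg_self 𝕜, one_mul]

theorem IsLogDeriv.norm_sub_expProd_le {y : ℕ → 𝔸} {R : 𝕜 → 𝔸} (h : IsLogDeriv y R) (m : ℕ)
    {T : ℝ} (hT : 0 < T) :
    ∃ K : ℝ, ∀ t : ℝ, |t| ≤ T →
      ‖R (t : 𝕜) - expProd (zassenhausExponent 𝕜 y) 1 m (t : 𝕜)‖ ≤ K * |t| ^ (m + 1) := by
  obtain ⟨Q, hQ, hR⟩ := h.exists_residual m
  obtain ⟨M, hM⟩ := (isCompact_Icc (a := -T) (b := T)).exists_bound_of_continuousOn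
    (f := fun t : ℝ => expProd (zassenhausExponent 𝕜 y) 1 m (t : 𝕜))
    ((continuous_expProd _ m).comp RCLike.continuous_ofReal).continuousOn
  set N := ∑' n, ‖residualCoeff 𝕜 y m n‖ * T ^ n
  refine ⟨M * (N * ‖(1 : 𝔸)‖ * Real.exp (T * N + 1) / T ^ m), fun t ht => ?_⟩
  have hQt := hQ.norm_sub_one_le (fun n hn => residualCoeff_eq_zero y hn) hT le_rfl (t := (t : 𝕜))
    (by rwa [RCLike.norm_ofReal])
  have hMt := hM t (abs_le.1 ht)
  rw [RCLike.norm_ofReal] at hQt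
  rw [hR, ← mul_sub_one]
  calc _ ≤ M * (|t| * (|t| / T) ^ m * (N * ‖(1 : 𝔸)‖ * Real.exp (T * N + 1))) :=
        (norm_mul_le _ _).trans (mul_le_mul hMt hQt (norm_nonneg _) ((norm_nonneg _).trans hMt))
    _ = _ := by rw [div_pow, pow_succ]; ring

theorem IsLogDeriv.sub_expProd_isBigO {y : ℕ → 𝔸} {R : 𝕜 → 𝔸} (h : IsLogDeriv y R) (m : ℕ) :
    (fun t : ℝ => R (t : 𝕜) - expProd (zassenhausExponent 𝕜 y) 1 m (t : 𝕜))
      =O[𝓝 0] fun t : ℝ => t ^ (m + 1) := by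
  obtain ⟨K, hK⟩ := h.norm_sub_expProd_le m one_pos
  refine IsBigO.of_bound K ?_
  filter_upwards [Metric.closedBall_mem_nhds (0 : ℝ) one_pos] with t ht
  rw [mem_closedBall_zero_iff] at ht
  rw [norm_pow]
  exact hK t ht

/-- The residual `Q m` is within a constant times `(|t| / r) ^ m` of `1`, uniformly in `m`. It is
therefore eventually invertible, and the partial product `R (Q m)⁻¹` tends to `R`. -/
theorem IsLogDeriv.tendsto_expProd {y : ℕ → 𝔸} {R : 𝕜 → 𝔸} (h : IsLogDeriv y R) :
    ∃ r > 0, ∀ t : ℝ, |t| < r →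
      Tendsto (fun m => expProd (zassenhausExponent 𝕜 y) 1 m (t : 𝕜)) atTop (𝓝 (R (t : 𝕜))) := by
  choose Q hQ hR using h.exists_residual
  set U := ∑' n, ‖y n‖ * 1 ^ n with hU
  have hU0 : 0 ≤ U := tsum_nonneg fun n => by positivity
  -- Ensures both `4 r U ≤ 1` and `r ≤ 1`; the latter bounds the norm at radius `r` by `U`, the norm
  -- at radius `1`.
  set r : ℝ := (4 * (U + 1))⁻¹ with hr
  have hr0 : 0 < r := by positivity
  have hr1 : r ≤ 1 := inv_le_one_of_one_le₀ (by linarith)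
  have hrU : 4 * (r * U) ≤ 1 := by
    rw [hr, ← mul_assoc, mul_inv_rev, mul_comm 4, inv_mul_cancel_right₀ (by norm_num)]
    rw [inv_mul_le_one₀ (by positivity)]
    linarith
  have hsU : ∑' n, ‖y n‖ * r ^ n ≤ U :=
    (h.summable r hr0.le).tsum_le_tsum (fun n => by gcongr) (h.summable 1 zero_le_one)
  refine ⟨r, hr0, fun t ht => ?_⟩
  have hlim : Tendsto (fun m => Q m (t : 𝕜)) atTop (𝓝 1) := by
    rw [tendsto_iff_norm_sub_tendsto_zero]
    refine squeeze_zero (fun _ => norm_nonneg _) (fun m =>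
      (hQ m).norm_sub_one_le (fun n hn => residualCoeff_eq_zero y hn) hr0
        (tsum_residualCoeff_le hr0 hrU (h.summable r hr0.le) hsU m).2 (t := (t : 𝕜))
        (by rw [RCLike.norm_ofReal]; exact ht.le)) ?_
    rw [RCLike.norm_ofReal]
    have := tendsto_pow_atTop_nhds_zero_of_lt_one (r := |t| / r) (by positivity)
      ((div_lt_one hr0).2 ht)
    simpa using (this.const_mul |t|).mul_const (U * ‖(1 : 𝔸)‖ * Real.exp (r * U + 1))
  have hinv : Tendsto (fun m => Ring.inverse (Q m (t : 𝕜))) atTop (𝓝 1) := by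
    simpa [Function.comp_def] using
      (NormedRing.inverse_continuousAt (1 : 𝔸ˣ)).tendsto.comp hlim
  have hlim' := hinv.const_mul (R (t : 𝕜))
  rw [mul_one] at hlim'
  refine hlim'.congr' ?_
  filter_upwards [hlim.eventually (Units.isOpen.mem_nhds isUnit_one)] with m hm
  rw [hR m, mul_assoc, Ring.mul_inverse_cancel _ hm, mul_one]

theorem eq_zero_of_exp_sub_one_isBigO {c : 𝔸} {k : ℕ} (hk : 0 < k)
    (h : (fun t : ℝ => NormedSpace.exp ((t : 𝕜) ^ k • c) - 1) =O[𝓝 0] fun t : ℝ => t ^ (k + 1)) :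
    c = 0 := by
  have hd := (hasDerivAt_exp_smul_const (𝕂 := 𝕜) c 0).isLittleO
  simp only [zero_smul, NormedSpace.exp_zero, one_mul, sub_zero] at hd
  have ht : Tendsto (fun t : ℝ => (t : 𝕜) ^ k) (𝓝 0) (𝓝 0) := by
    have : Continuous fun t : ℝ => (t : 𝕜) ^ k := RCLike.continuous_ofReal.pow k
    simpa [hk.ne'] using this.tendsto 0
  have hd' := hd.comp_tendsto ht
  have hnorm : (fun t : ℝ => (t : 𝕜) ^ k) =O[𝓝 0] fun t : ℝ => t ^ k :=
    .of_bound 1 (.of_forall fun t => by simp)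
  have hpow : (fun t : ℝ => t ^ (k + 1)) =o[𝓝 0] fun t : ℝ => t ^ k :=
    isLittleO_pow_pow k.lt_succ_self
  have h₁ : (fun t : ℝ => (t : 𝕜) ^ k • c) =o[𝓝 0] fun t : ℝ => t ^ k := by
    refine ((h.trans_isLittleO hpow).sub (hd'.trans_isBigO hnorm)).congr_left fun t => ?_
    simp
  by_contra hc
  have hc' : 0 < ‖c‖ := norm_pos_iff.2 hc
  obtain ⟨t, ht₁, ht₂⟩ :=
    (((h₁.def (half_pos hc')).filter_mono nhdsWithin_le_nhds).and
      (self_mem_nhdsWithin (s := {0}ᶜ))).exists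
  have ht₃ : 0 < |t| ^ k := pow_pos (abs_pos.2 ht₂) k
  rw [norm_smul, norm_pow, norm_pow, RCLike.norm_ofReal, Real.norm_eq_abs] at ht₁
  nlinarith

theorem isBigO_pow_pow_of_le {m n : ℕ} (h : m ≤ n) :
    (fun t : ℝ => t ^ n) =O[𝓝 0] fun t : ℝ => t ^ m := by
  refine IsBigO.of_bound 1 ?_
  filter_upwards [Metric.closedBall_mem_nhds (0 : ℝ) one_pos] with t ht
  rw [mem_closedBall_zero_iff] at ht
  rw [norm_pow, norm_pow, one_mul]
  exact pow_le_pow_of_le_one (norm_nonneg t) ht h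

/-- If the coefficients below `q` vanish, one factor `exp (c t^(q+1))` with `c` proportional to `y
q` brings `R` to `1 + O(t^(q+2))`. As `R` already has that form, so has the factor, whence `c = 0`.
-/
theorem IsLogDeriv.eq_zero_of_isBigO {y : ℕ → 𝔸} {R : 𝕜 → 𝔸} (h : IsLogDeriv y R) {p : ℕ}
    (hR : (fun t : ℝ => R (t : 𝕜) - 1) =O[𝓝 0] fun t : ℝ => t ^ (p + 1)) {n : ℕ} (hn : n < p) :
    y n = 0 := by
  induction n using Nat.strong_induction_on with
  | _ q ih =>
    have hy : residualCoeff 𝕜 y q = y :=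
      residualCoeff_eq_self (fun n h => ih n h (h.trans hn)) le_rfl
    have hR' : (fun t : ℝ => R (t : 𝕜) - 1) =O[𝓝 0] fun t : ℝ => t ^ (q + 1 + 1) :=
      hR.trans (isBigO_pow_pow_of_le (by omega))
    set c : 𝔸 := -(((q + 1 : ℕ) : 𝕜)⁻¹ • y q) with hc
    have hres : residualCoeff 𝕜 y (q + 1) = leftMulExp 𝕜 (q + 1) c y := by
      rw [residualCoeff, hy]
    have h₁ := (h.exp_mul q.succ_pos c).sub_one_isBigO (q := q + 1)
      fun n hn => by rw [← hres, residualCoeff_eq_zero y hn]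
    have h₂ : (fun t : ℝ => NormedSpace.exp ((t : 𝕜) ^ (q + 1) • c)) =O[𝓝 0] fun _ => (1 : ℝ) :=
      (((continuous_exp_pow_smul 𝕜 (q + 1) c).comp RCLike.continuous_ofReal).tendsto 0).isBigO_one ℝ
    have h₃ : c = 0 := by
      refine eq_zero_of_exp_sub_one_isBigO (𝕜 := 𝕜) q.succ_pos ?_
      have h₄ := h₂.mul hR'
      simp only [one_mul] at h₄
      refine (h₁.sub h₄).congr_left fun t => ?_
      rw [mul_sub_one]
      abel
    rw [hc, neg_eq_zero, smul_eq_zero] at h₃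
    exact h₃.resolve_left (inv_ne_zero (Nat.cast_ne_zero.2 q.succ_ne_zero))

/-- The product of the exponentials `exp (t • c)` for `c` in a list. -/
noncomputable def listExp (l : List 𝔸) (t : 𝕜) : 𝔸 :=
  (l.map fun c => NormedSpace.exp (t • c)).prod

theorem isLogDeriv_listExp (l : List 𝔸) :
    IsLogDeriv (logDerivCoeff 𝕜 l) fun t : 𝕜 => listExp l t := by
  induction l with
  | nil => exact isLogDeriv_zero
  | cons c l ih => simpa [listExp, logDerivCoeff] using ih.exp_mul one_pos c

end Estimates

/-! ### Inverses and bounds for products of exponentials -/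

section ListExp

variable {𝕜 : Type*} [RCLike 𝕜] {𝔸 : Type*} [NormedRing 𝔸] [NormedAlgebra 𝕜 𝔸]

theorem listExp_append (l₁ l₂ : List 𝔸) (t : 𝕜) :
    listExp (l₁ ++ l₂) t = listExp l₁ t * listExp l₂ t := by
  simp [listExp]

variable [CompleteSpace 𝔸]

theorem listExp_mul_listExp_neg_reverse (l : List 𝔸) (t : 𝕜) :
    listExp l t * listExp (l.map Neg.neg).reverse t = 1 := by
  induction l with
  | nil => simp [listExp]
  | cons c l ih =>
    rw [List.map_cons, List.reverse_cons, listExp_append, ← List.singleton_append, listExp_append,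
      mul_assoc, ← mul_assoc (listExp l t), ih, one_mul]
    simpa [listExp] using exp_mul_exp_neg_self 𝕜 (t • c)

theorem listExp_neg_reverse_mul_listExp (l : List 𝔸) (t : 𝕜) :
    listExp (l.map Neg.neg).reverse t * listExp l t = 1 := by
  have := listExp_mul_listExp_neg_reverse (l.map Neg.neg).reverse t
  simpa [List.map_reverse] using this

theorem continuous_listExp (l : List 𝔸) : Continuous fun t : ℝ => listExp l (t : 𝕜) := by
  induction l with
  | nil => simpa [listExp] using continuous_const
  | cons c l ih =>
    have h := (continuous_exp_pow_smul 𝕜 1 c).comp RCLike.continuous_ofReal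
    simp only [pow_one] at h
    simp only [listExp, List.map_cons, List.prod_cons]
    exact h.mul ih

theorem listExp_isBigO_one (l : List 𝔸) :
    (fun t : ℝ => listExp l (t : 𝕜)) =O[𝓝 0] fun _ => (1 : ℝ) :=
  ((continuous_listExp l).tendsto 0).isBigO_one ℝ

end ListExp

/-! ### Universal Zassenhaus exponents and their evaluation -/

section Zassenhaus

attribute [local instance] LieRing.ofAssociativeRing

variable {𝕜 : Type*} [RCLike 𝕜]

/-- The Lie polynomials `C_k` with `∏ exp (t • c) = exp (C_1 t) exp (C_2 t ^ 2) ⋯`, where the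
left-hand product is over the given list. -/
noncomputable def zassenhausOfList (l : List (FreeLieAlgebra 𝕜 (Fin 2))) :
    ℕ → FreeLieAlgebra 𝕜 (Fin 2) :=
  zassenhausExponent 𝕜 (logDerivCoeff 𝕜 l)

theorem zassenhausOfList_mem {l : List (FreeLieAlgebra 𝕜 (Fin 2))}
    (hl : ∀ c ∈ l, c ∈ lieHomogeneous 𝕜 1) (k : ℕ) :
    zassenhausOfList l k ∈ lieHomogeneous 𝕜 k :=
  zassenhausExponent_mem_lieHomogeneous (logDerivCoeff_mem_lieHomogeneous hl) k

variable {X : Type*} [NormedAddCommGroup X] [NormedSpace 𝕜 X] (A B : X →L[𝕜] X)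

theorem lieEval_zassenhausOfList (l : List (FreeLieAlgebra 𝕜 (Fin 2))) (k : ℕ) :
    lieEval A B (zassenhausOfList l k) =
      zassenhausExponent 𝕜 (logDerivCoeff 𝕜 (l.map (lieEval A B))) k := by
  unfold lieEval zassenhausOfList
  simp only [map_zassenhausExponent, map_logDerivCoeff]

theorem zassenhausProd_eq_expProd (l : List (FreeLieAlgebra 𝕜 (Fin 2))) (q m : ℕ) (t : ℝ) :
    zassenhausProd (zassenhausOfList l) A B q m t =
      expProd (zassenhausExponent 𝕜 (logDerivCoeff 𝕜 (l.map (lieEval A B)))) q m (t : 𝕜) := by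
  simp only [zassenhausProd, expProd, lieEval_zassenhausOfList]

variable [CompleteSpace X]

/-- The hypothesis concerns one pair `A, B`, so the low exponents are shown to vanish after
evaluation; they need not vanish in the free Lie algebra. -/
theorem zassenhausProd_eq_of_isBigO {l : List (FreeLieAlgebra 𝕜 (Fin 2))} {p : ℕ}
    (h : (fun t : ℝ => listExp (l.map (lieEval A B)) (t : 𝕜) - 1) =O[𝓝 0]
      fun t : ℝ => t ^ (p + 1)) (m : ℕ) (t : ℝ) :
    zassenhausProd (zassenhausOfList l) A B (p + 1) m t =
      zassenhausProd (zassenhausOfList l) A B 1 m t := by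
  rw [zassenhausProd_eq_expProd, zassenhausProd_eq_expProd]
  refine expProd_eq_of_eq_zero (fun k hk => zassenhausExponent_eq_zero (p := p) ?_ hk) m _
  exact fun n hn => (isLogDeriv_listExp _).eq_zero_of_isBigO h hn

theorem listExp_sub_one_isBigO {l : List (FreeLieAlgebra 𝕜 (Fin 2))} {p : ℕ}
    (h : ∀ n < p, logDerivCoeff 𝕜 l n = 0) :
    (fun t : ℝ => listExp (l.map (lieEval A B)) (t : 𝕜) - 1) =O[𝓝 0] fun t : ℝ => t ^ (p + 1) := by
  refine (isLogDeriv_listExp _).sub_one_isBigO fun n hn => ?_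
  have := map_logDerivCoeff (FreeLieAlgebra.lift 𝕜 ![A, B]) l n
  rw [h n hn, map_zero] at this
  exact this.symm

theorem listExp_sub_zassenhausProd_isBigO {l : List (FreeLieAlgebra 𝕜 (Fin 2))} {p : ℕ}
    (h : (fun t : ℝ => listExp (l.map (lieEval A B)) (t : 𝕜) - 1) =O[𝓝 0]
      fun t : ℝ => t ^ (p + 1)) (m : ℕ) :
    (fun t : ℝ => listExp (l.map (lieEval A B)) (t : 𝕜) -
      zassenhausProd (zassenhausOfList l) A B (p + 1) m t) =O[𝓝 0] fun t : ℝ => t ^ (m + 1) := by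
  simp only [zassenhausProd_eq_of_isBigO A B h, zassenhausProd_eq_expProd]
  exact (isLogDeriv_listExp _).sub_expProd_isBigO m

theorem tendsto_zassenhausProd {l : List (FreeLieAlgebra 𝕜 (Fin 2))} {p : ℕ}
    (h : (fun t : ℝ => listExp (l.map (lieEval A B)) (t : 𝕜) - 1) =O[𝓝 0]
      fun t : ℝ => t ^ (p + 1)) :
    ∃ r > 0, ∀ t : ℝ, |t| < r →
      Tendsto (fun m => zassenhausProd (zassenhausOfList l) A B (p + 1) m t) atTop
        (𝓝 (listExp (l.map (lieEval A B)) (t : 𝕜))) := by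
  simp only [zassenhausProd_eq_of_isBigO A B h, zassenhausProd_eq_expProd]
  exact (isLogDeriv_listExp _).tendsto_expProd

theorem norm_listExp_sub_zassenhausProd_le {l : List (FreeLieAlgebra 𝕜 (Fin 2))} {p : ℕ}
    (h : (fun t : ℝ => listExp (l.map (lieEval A B)) (t : 𝕜) - 1) =O[𝓝 0]
      fun t : ℝ => t ^ (p + 1)) (m : ℕ) {T : ℝ} (hT : 0 < T) :
    ∃ K : ℝ, ∀ t : ℝ, |t| ≤ T →
      ‖listExp (l.map (lieEval A B)) (t : 𝕜) -
        zassenhausProd (zassenhausOfList l) A B (p + 1) m t‖ ≤ K * |t| ^ (m + 1) := by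
  simp only [zassenhausProd_eq_of_isBigO A B h, zassenhausProd_eq_expProd]
  exact (isLogDeriv_listExp _).norm_sub_expProd_le m hT

end Zassenhaus

/-! ### Splitting schemes and their defects -/

section Scheme

attribute [local instance] LieRing.ofAssociativeRing

variable {𝕜 : Type*} [RCLike 𝕜]

theorem of_mem_lieHomogeneous (i : Fin 2) : FreeLieAlgebra.of 𝕜 i ∈ lieHomogeneous 𝕜 1 :=
  Submodule.subset_span (.of i)

/-- The exponents of the factors of a splitting scheme. -/
noncomputable def schemeList {j : ℕ} (a b : Fin j → 𝕜) : List (FreeLieAlgebra 𝕜 (Fin 2)) :=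
  (List.ofFn fun i => [a i • FreeLieAlgebra.of 𝕜 0, b i • FreeLieAlgebra.of 𝕜 1]).flatten

/-- The exponents of `(S t)⁻¹ exp ((A + B) t)` for a splitting scheme `S`. -/
noncomputable def defectList {j : ℕ} (a b : Fin j → 𝕜) : List (FreeLieAlgebra 𝕜 (Fin 2)) :=
  ((schemeList a b).map Neg.neg).reverse ++ [FreeLieAlgebra.of 𝕜 0 + FreeLieAlgebra.of 𝕜 1]

theorem defectList_mem {j : ℕ} (a b : Fin j → 𝕜) :
    ∀ c ∈ defectList a b, c ∈ lieHomogeneous 𝕜 1 := by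
  have h : ∀ c ∈ schemeList a b, c ∈ lieHomogeneous 𝕜 1 := by
    intro c hc
    simp only [schemeList, List.mem_flatten, List.mem_ofFn] at hc
    obtain ⟨_, ⟨i, rfl⟩, hc⟩ := hc
    simp only [List.mem_cons, List.not_mem_nil, or_false] at hc
    rcases hc with rfl | rfl <;> exact Submodule.smul_mem _ _ (of_mem_lieHomogeneous _)
  intro c hc
  simp only [defectList, List.mem_append, List.mem_reverse, List.mem_map, List.mem_singleton] at hc
  rcases hc with ⟨d, hd, rfl⟩ | rfl
  · exact neg_mem (h d hd)
  · exact add_mem (of_mem_lieHomogeneous _) (of_mem_lieHomogeneous _)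

variable {X : Type*} [NormedAddCommGroup X] [NormedSpace 𝕜 X] (A B : X →L[𝕜] X)

theorem lieEval_of_zero : lieEval A B (FreeLieAlgebra.of 𝕜 0) = A := by
  simp [lieEval]

theorem lieEval_of_one : lieEval A B (FreeLieAlgebra.of 𝕜 1) = B := by
  simp [lieEval]

theorem lieEval_add (P Q : FreeLieAlgebra 𝕜 (Fin 2)) :
    lieEval A B (P + Q) = lieEval A B P + lieEval A B Q := map_add (FreeLieAlgebra.lift 𝕜 _) P Q

theorem lieEval_neg (P : FreeLieAlgebra 𝕜 (Fin 2)) :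
    lieEval A B (-P) = -lieEval A B P := map_neg (FreeLieAlgebra.lift 𝕜 _) P

theorem lieEval_smul (a : 𝕜) (P : FreeLieAlgebra 𝕜 (Fin 2)) :
    lieEval A B (a • P) = a • lieEval A B P := map_smul (FreeLieAlgebra.lift 𝕜 _) a P

theorem splitting_eq_listExp {j : ℕ} (a b : Fin j → 𝕜) (t : ℝ) :
    splitting a b A B t = listExp ((schemeList a b).map (lieEval A B)) (t : 𝕜) := by
  simp only [splitting, listExp, schemeList, List.map_flatten, List.prod_flatten, List.map_ofFn]
  congr 2
  ext1 i
  simp [lieEval_smul, lieEval_of_zero, lieEval_of_one, smul_smul, mul_comm]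

variable [CompleteSpace X]

theorem splitting_mul_defect {j : ℕ} (a b : Fin j → 𝕜) (t : ℝ) :
    splitting a b A B t * listExp ((defectList a b).map (lieEval A B)) (t : 𝕜) =
      NormedSpace.exp ((t : 𝕜) • (A + B)) := by
  have h : (((schemeList a b).map Neg.neg).reverse).map (lieEval A B) =
      (((schemeList a b).map (lieEval A B)).map Neg.neg).reverse := by
    rw [List.map_reverse, List.map_map, List.map_map]
    congr 2
    ext1 P
    exact lieEval_neg A B P
  rw [defectList, List.map_append, listExp_append, h, splitting_eq_listExp, ← mul_assoc,
    listExp_mul_listExp_neg_reverse, one_mul]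
  simp [listExp, lieEval_add, lieEval_of_zero, lieEval_of_one]

theorem exp_sub_splitting_mul {j : ℕ} (a b : Fin j → 𝕜) (t : ℝ) (Z : X →L[𝕜] X) :
    NormedSpace.exp ((t : 𝕜) • (A + B)) - splitting a b A B t * Z =
      listExp ((schemeList a b).map (lieEval A B)) (t : 𝕜) *
        (listExp ((defectList a b).map (lieEval A B)) (t : 𝕜) - Z) := by
  rw [← splitting_mul_defect A B a b t, ← mul_sub, splitting_eq_listExp]

/-- Both `S(t)` and `S(t)⁻¹` are bounded near `0`, so multiplying by either preserves the order. -/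
theorem splittingHasOrder_iff {j : ℕ} (a b : Fin j → 𝕜) (p : ℕ) :
    SplittingHasOrder a b A B p ↔
      (fun t : ℝ => listExp ((defectList a b).map (lieEval A B)) (t : 𝕜) - 1) =O[𝓝 0]
        fun t : ℝ => t ^ (p + 1) := by
  have h (t : ℝ) : NormedSpace.exp ((t : 𝕜) • (A + B)) - splitting a b A B t =
      listExp ((schemeList a b).map (lieEval A B)) (t : 𝕜) *
        (listExp ((defectList a b).map (lieEval A B)) (t : 𝕜) - 1) := by
    simpa using exp_sub_splitting_mul A B a b t 1
  unfold SplittingHasOrder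
  simp only [h]
  constructor <;> intro ho
  · have := (listExp_isBigO_one (𝕜 := 𝕜)
      (((schemeList a b).map (lieEval A B)).map Neg.neg).reverse).mul ho
    simpa only [← mul_assoc, listExp_neg_reverse_mul_listExp, one_mul] using this
  · simpa only [one_mul] using
      (listExp_isBigO_one (𝕜 := 𝕜) ((schemeList a b).map (lieEval A B))).mul ho

theorem lie_of_one_of_zero :
    ⁅FreeLieAlgebra.of 𝕜 (1 : Fin 2), FreeLieAlgebra.of 𝕜 (0 : Fin 2)⁆ =
      -⁅FreeLieAlgebra.of 𝕜 (0 : Fin 2), FreeLieAlgebra.of 𝕜 (1 : Fin 2)⁆ :=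
  (lie_skew _ _).symm

theorem logDerivCoeff_defectList_trotter :
    ∀ n < 1, logDerivCoeff 𝕜 (defectList ![(1 : 𝕜)] ![(1 : 𝕜)]) n = 0 := by
  intro n hn
  interval_cases n
  simp [defectList, schemeList, logDerivCoeff, leftMulExp_one_zero]

theorem logDerivCoeff_defectList_strang :
    ∀ n < 2, logDerivCoeff 𝕜
      (defectList ![(1 / 2 : 𝕜), (1 / 2 : 𝕜)] ![(1 : 𝕜), (0 : 𝕜)]) n = 0 := by
  intro n hn
  interval_cases n
  · simp [defectList, schemeList, logDerivCoeff, leftMulExp_one_zero]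
    module
  -- Every bracket is oriented as `⁅A, B⁆`; `lie_skew` would undo this.
  · simp [defectList, schemeList, logDerivCoeff, leftMulExp_one_zero, leftMulExp_one_one,
      lie_of_one_of_zero, -lie_skew]
    module

end Scheme

/-! ### The Cauchy problem -/

section Cauchy

variable {𝕜 : Type*} [RCLike 𝕜] {X : Type*} [NormedAddCommGroup X] [NormedSpace 𝕜 X]
  [NormedSpace ℝ X] [IsScalarTower ℝ 𝕜 X] [CompleteSpace X] (A B : X →L[𝕜] X)

theorem hasDerivAt_exp_smul_apply (M : X →L[𝕜] X) (x : X) (t : ℝ) :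
    HasDerivAt (fun t : ℝ => NormedSpace.exp ((t : 𝕜) • M) x)
      (M (NormedSpace.exp ((t : 𝕜) • M) x)) t := by
  have h₁ : HasDerivAt (fun z : 𝕜 => NormedSpace.exp (z • M) x)
      (M (NormedSpace.exp ((t : 𝕜) • M) x)) (t : 𝕜) :=
    (ContinuousLinearMap.apply 𝕜 X x).hasFDerivAt.comp_hasDerivAt (t : 𝕜)
      (hasDerivAt_exp_smul_const' M (t : 𝕜))
  simpa [Function.comp_def] using h₁.scomp t (RCLike.ofRealCLM (K := 𝕜)).hasDerivAt

theorem isCauchySolution_iff {T : ℝ} (hT : 0 < T) (c₀ : X) (c : ℝ → X) :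
    IsCauchySolution A B T c₀ c ↔
      ∀ t ∈ Set.Icc 0 T, c t = NormedSpace.exp ((t : 𝕜) • (A + B)) c₀ := by
  have h0 : NormedSpace.exp (((0 : ℝ) : 𝕜) • (A + B)) c₀ = c₀ := by simp
  constructor
  · rintro ⟨hc0, hc⟩
    refine ODE_solution_unique_of_mem_Icc_right (v := fun _ x => (A + B) x)
      (s := fun _ => Set.univ) (K := ‖A + B‖₊) (fun t _ => (A + B).lipschitz.lipschitzOnWith)
      (fun t ht => (hc t ht).continuousWithinAt) (fun t ht => ?_) (fun _ _ => trivial)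
      (fun t _ => (hasDerivAt_exp_smul_apply (A + B) c₀ t).continuousAt.continuousWithinAt)
      (fun t _ => (hasDerivAt_exp_smul_apply (A + B) c₀ t).hasDerivWithinAt) (fun _ _ => trivial)
      (hc0.trans h0.symm)
    -- For `t < T` the derivative within `[0, T]` yields the right derivative that ODE uniqueness
    -- asks for.
    exact (hc t (Set.Ico_subset_Icc_self ht)).mono_of_mem_nhdsWithin (Icc_mem_nhdsGE_of_mem ht)
  · intro hc
    refine ⟨(hc 0 (by simp [hT.le])).trans h0, fun t ht => ?_⟩
    have := ((hasDerivAt_exp_smul_apply (A + B) c₀ t).hasDerivWithinAt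
      (s := Set.Icc 0 T)).congr hc (hc t ht)
    rwa [← hc t ht] at this

end Cauchy

/-! ### The two half steps around the Strang scheme -/

section HalfSteps

attribute [local instance] LieRing.ofAssociativeRing

variable {𝕜 : Type*} [RCLike 𝕜]

variable (𝕜) in
/-- The exponents of `exp ((A / 2 + B / 2) t) exp (-B t / 2) exp (-A t / 2)`. -/
noncomputable def leftHalfList : List (FreeLieAlgebra 𝕜 (Fin 2)) :=
  [(1 / 2 : 𝕜) • FreeLieAlgebra.of 𝕜 0 + (1 / 2 : 𝕜) • FreeLieAlgebra.of 𝕜 1,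
    -((1 / 2 : 𝕜) • FreeLieAlgebra.of 𝕜 1), -((1 / 2 : 𝕜) • FreeLieAlgebra.of 𝕜 0)]

variable (𝕜) in
/-- The exponents of `exp (-A t / 2) exp (-B t / 2) exp ((B / 2 + A / 2) t)`. -/
noncomputable def rightHalfList : List (FreeLieAlgebra 𝕜 (Fin 2)) :=
  [-((1 / 2 : 𝕜) • FreeLieAlgebra.of 𝕜 0), -((1 / 2 : 𝕜) • FreeLieAlgebra.of 𝕜 1),
    (1 / 2 : 𝕜) • FreeLieAlgebra.of 𝕜 1 + (1 / 2 : 𝕜) • FreeLieAlgebra.of 𝕜 0]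

theorem halfList_mem :
    ∀ c ∈ leftHalfList 𝕜 ++ rightHalfList 𝕜, c ∈ lieHomogeneous 𝕜 1 := by
  have h (i : Fin 2) : (1 / 2 : 𝕜) • FreeLieAlgebra.of 𝕜 i ∈ lieHomogeneous 𝕜 1 :=
    Submodule.smul_mem _ _ (of_mem_lieHomogeneous i)
  intro c hc
  simp only [leftHalfList, rightHalfList, List.mem_append, List.mem_cons, List.not_mem_nil,
    or_false] at hc
  rcases hc with (rfl | rfl | rfl) | rfl | rfl | rfl
  exacts [add_mem (h 0) (h 1), neg_mem (h 1), neg_mem (h 0), neg_mem (h 0), neg_mem (h 1),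
    add_mem (h 1) (h 0)]

theorem logDerivCoeff_leftHalfList : ∀ n < 1, logDerivCoeff 𝕜 (leftHalfList 𝕜) n = 0 := by
  intro n hn
  interval_cases n
  simp only [leftHalfList, logDerivCoeff, leftMulExp_one_zero, Pi.zero_apply]
  module

theorem logDerivCoeff_rightHalfList : ∀ n < 1, logDerivCoeff 𝕜 (rightHalfList 𝕜) n = 0 := by
  intro n hn
  interval_cases n
  simp only [rightHalfList, logDerivCoeff, leftMulExp_one_zero, Pi.zero_apply]
  module

/-- The second-order defects of the two half steps are opposite multiples of `⁅A, B⁆`, because the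
order of the factors is reversed; this is why `D` starts at `k = 3`. -/
theorem logDerivCoeff_halfList :
    ∀ n < 2, logDerivCoeff 𝕜 (leftHalfList 𝕜 ++ rightHalfList 𝕜) n = 0 := by
  intro n hn
  interval_cases n
  · simp only [leftHalfList, rightHalfList, List.cons_append, List.nil_append, logDerivCoeff,
      leftMulExp_one_zero, Pi.zero_apply]
    module
  · simp only [leftHalfList, rightHalfList, List.cons_append, List.nil_append, logDerivCoeff,
      leftMulExp_one_zero, leftMulExp_one_one, Pi.zero_apply, lie_add, add_lie, lie_neg, neg_lie,
      lie_smul, smul_lie, lie_self, lie_zero, lie_of_one_of_zero]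
    module

variable {X : Type*} [NormedAddCommGroup X] [NormedSpace 𝕜 X] (A B : X →L[𝕜] X)

theorem listExp_leftHalfList (t : 𝕜) :
    listExp ((leftHalfList 𝕜).map (lieEval A B)) t =
      NormedSpace.exp (t • ((1 / 2 : 𝕜) • A + (1 / 2 : 𝕜) • B)) *
        NormedSpace.exp (-(t • ((1 / 2 : 𝕜) • B))) * NormedSpace.exp (-(t • ((1 / 2 : 𝕜) • A))) := by
  simp only [listExp, leftHalfList, List.map_cons, List.map_nil, List.prod_cons, List.prod_nil,
    lieEval_add, lieEval_neg, lieEval_smul, lieEval_of_zero, lieEval_of_one, smul_neg, mul_one,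
    mul_assoc]

theorem listExp_rightHalfList (t : 𝕜) :
    listExp ((rightHalfList 𝕜).map (lieEval A B)) t =
      NormedSpace.exp (-(t • ((1 / 2 : 𝕜) • A))) * NormedSpace.exp (-(t • ((1 / 2 : 𝕜) • B))) *
        NormedSpace.exp (t • ((1 / 2 : 𝕜) • B + (1 / 2 : 𝕜) • A)) := by
  simp only [listExp, rightHalfList, List.map_cons, List.map_nil, List.prod_cons, List.prod_nil,
    lieEval_add, lieEval_neg, lieEval_smul, lieEval_of_zero, lieEval_of_one, smul_neg, mul_one,
    mul_assoc]

variable [CompleteSpace X]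

theorem exp_half_eq_left (t : 𝕜) :
    NormedSpace.exp (t • ((1 / 2 : 𝕜) • A + (1 / 2 : 𝕜) • B)) =
      listExp ((leftHalfList 𝕜).map (lieEval A B)) t * NormedSpace.exp (t • ((1 / 2 : 𝕜) • A)) *
        NormedSpace.exp (t • ((1 / 2 : 𝕜) • B)) := by
  rw [listExp_leftHalfList, mul_assoc _ (NormedSpace.exp (-_)) (NormedSpace.exp _),
    exp_neg_mul_exp_self 𝕜, mul_one, mul_assoc, exp_neg_mul_exp_self 𝕜, mul_one]

theorem exp_half_eq_right (t : 𝕜) :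
    NormedSpace.exp (t • ((1 / 2 : 𝕜) • B + (1 / 2 : 𝕜) • A)) =
      NormedSpace.exp (t • ((1 / 2 : 𝕜) • B)) * NormedSpace.exp (t • ((1 / 2 : 𝕜) • A)) *
        listExp ((rightHalfList 𝕜).map (lieEval A B)) t := by
  rw [listExp_rightHalfList, mul_assoc, ← mul_assoc (NormedSpace.exp (t • ((1 / 2 : 𝕜) • A))),
    ← mul_assoc (NormedSpace.exp (t • ((1 / 2 : 𝕜) • A))), exp_mul_exp_neg_self 𝕜, one_mul,
    ← mul_assoc, exp_mul_exp_neg_self 𝕜, one_mul]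

/-- The full flow is the square of the half flow. Writing one half with `a b` and the other with `b
a` makes the inner factors `a b b a`, the Strang scheme. -/
theorem exp_eq_half_mul_strang_mul_half (t : ℝ) :
    NormedSpace.exp ((t : 𝕜) • (A + B)) =
      listExp ((leftHalfList 𝕜).map (lieEval A B)) (t : 𝕜) *
        splitting ![(1 / 2 : 𝕜), (1 / 2 : 𝕜)] ![(1 : 𝕜), (0 : 𝕜)] A B t *
          listExp ((rightHalfList 𝕜).map (lieEval A B)) (t : 𝕜) := by
  let _ : NormedAlgebra ℚ (X →L[𝕜] X) := .restrictScalars ℚ 𝕜 _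
  set a := NormedSpace.exp ((t : 𝕜) • ((1 / 2 : 𝕜) • A)) with ha
  set b := NormedSpace.exp ((t : 𝕜) • ((1 / 2 : 𝕜) • B)) with hb
  have hS : splitting ![(1 / 2 : 𝕜), (1 / 2 : 𝕜)] ![(1 : 𝕜), (0 : 𝕜)] A B t = a * b * (b * a) := by
    have hB : NormedSpace.exp ((t : 𝕜) • B) = b * b := by
      rw [hb, ← NormedSpace.exp_add_of_commute (Commute.refl _)]
      congr 1
      module
    have hA : NormedSpace.exp (((1 / 2 : 𝕜) * (t : 𝕜)) • A) = a := by
      rw [ha, smul_smul, mul_comm]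
    simp only [splitting, List.ofFn_succ, List.ofFn_zero, List.prod_cons, List.prod_nil,
      Matrix.cons_val_zero, Matrix.cons_val_one, Fin.succ_zero_eq_one, one_mul, zero_mul, zero_smul,
      NormedSpace.exp_zero, mul_one, hA, hB, mul_assoc]
  have hexp : NormedSpace.exp ((t : 𝕜) • (A + B)) =
      NormedSpace.exp ((t : 𝕜) • ((1 / 2 : 𝕜) • A + (1 / 2 : 𝕜) • B)) *
        NormedSpace.exp ((t : 𝕜) • ((1 / 2 : 𝕜) • B + (1 / 2 : 𝕜) • A)) := by
    rw [add_comm ((1 / 2 : 𝕜) • B), ← NormedSpace.exp_add_of_commute (Commute.refl _)]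
    congr 1
    module
  rw [hS, hexp, exp_half_eq_left A B, exp_half_eq_right A B]
  simp only [ha, hb, mul_assoc]

end HalfSteps

theorem theorem2 {𝕜 : Type u} [RCLike 𝕜] :
    -- the Cauchy problem is solved by the exponential of `A + B`
    (∀ (X : Type v) [NormedAddCommGroup X] [NormedSpace 𝕜 X] [NormedSpace ℝ X]
      [IsScalarTower ℝ 𝕜 X] [CompleteSpace X] (A B : X →L[𝕜] X) (T : ℝ), 0 < T →
      ∀ (c₀ : X) (c : ℝ → X), IsCauchySolution A B T c₀ c ↔
        ∀ t ∈ Set.Icc 0 T, c t = NormedSpace.exp ((t : 𝕜) • (A + B)) c₀) ∧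
    -- every exponential splitting scheme is corrected by Zassenhaus factors, whose exponents are
    -- Lie polynomials that depend on the coefficients of the scheme only
    (∀ (j : ℕ) (a b : Fin j → 𝕜), ∃ C : ℕ → FreeLieAlgebra 𝕜 (Fin 2),
      (∀ k, C k ∈ lieHomogeneous 𝕜 k) ∧
      ∀ (X : Type v) [NormedAddCommGroup X] [NormedSpace 𝕜 X] [NormedSpace ℝ X]
        [IsScalarTower ℝ 𝕜 X] [CompleteSpace X] (A B : X →L[𝕜] X) (p : ℕ),
        SplittingHasOrder a b A B p →
        (∀ m : ℕ,
          (fun t : ℝ => NormedSpace.exp ((t : 𝕜) • (A + B)) -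
              splitting a b A B t * zassenhausProd C A B (p + 1) m t)
            =O[𝓝 0] fun t : ℝ => t ^ (m + 1)) ∧
        (∃ r > 0, ∀ t : ℝ, |t| < r →
          Tendsto (fun m : ℕ => splitting a b A B t * zassenhausProd C A B (p + 1) m t) atTop
            (𝓝 (NormedSpace.exp ((t : 𝕜) • (A + B))))) ∧
        (∀ (m : ℕ) (T : ℝ), 0 < T → ∃ K : ℝ, ∀ (c₀ : X) (c : ℝ → X),
          IsCauchySolution A B T c₀ c → ∀ t ∈ Set.Icc 0 T,
            ‖c t - (splitting a b A B t * zassenhausProd C A B (p + 1) m t) c₀‖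
              ≤ K * t ^ (m + 1) * ‖c₀‖)) ∧
    -- the Lie-Trotter scheme has order one, so that its correction starts at `k = 2`;
    -- the Strang scheme has order two, so that its correction starts at `k = 3`
    (∀ (X : Type v) [NormedAddCommGroup X] [NormedSpace 𝕜 X] [CompleteSpace X]
      (A B : X →L[𝕜] X),
      SplittingHasOrder ![(1 : 𝕜)] ![(1 : 𝕜)] A B 1 ∧
      SplittingHasOrder ![(1 / 2 : 𝕜), (1 / 2 : 𝕜)] ![(1 : 𝕜), (0 : 𝕜)] A B 2) ∧
    -- the two Zassenhaus products of the half steps combine to a product that starts at `k = 3`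
    (∃ C' C D : ℕ → FreeLieAlgebra 𝕜 (Fin 2),
      (∀ k, C' k ∈ lieHomogeneous 𝕜 k ∧ C k ∈ lieHomogeneous 𝕜 k ∧ D k ∈ lieHomogeneous 𝕜 k) ∧
      ∀ (X : Type v) [NormedAddCommGroup X] [NormedSpace 𝕜 X] [CompleteSpace X]
        (A B : X →L[𝕜] X),
        (∀ m : ℕ,
          ((fun t : ℝ => NormedSpace.exp ((t : 𝕜) • ((1 / 2 : 𝕜) • A + (1 / 2 : 𝕜) • B)) -
              zassenhausProd C' A B 2 m t * NormedSpace.exp ((t : 𝕜) • ((1 / 2 : 𝕜) • A)) *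
                NormedSpace.exp ((t : 𝕜) • ((1 / 2 : 𝕜) • B)))
            =O[𝓝 0] fun t : ℝ => t ^ (m + 1)) ∧
          ((fun t : ℝ => NormedSpace.exp ((t : 𝕜) • ((1 / 2 : 𝕜) • B + (1 / 2 : 𝕜) • A)) -
              NormedSpace.exp ((t : 𝕜) • ((1 / 2 : 𝕜) • B)) *
                NormedSpace.exp ((t : 𝕜) • ((1 / 2 : 𝕜) • A)) * zassenhausProd C A B 2 m t)
            =O[𝓝 0] fun t : ℝ => t ^ (m + 1)) ∧
          ((fun t : ℝ => zassenhausProd C' A B 2 m t * zassenhausProd C A B 2 m t -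
              zassenhausProd D A B 3 m t)
            =O[𝓝 0] fun t : ℝ => t ^ (m + 1))) ∧
        (∃ r > 0, ∀ t : ℝ, |t| < r → ∃ P' P : X →L[𝕜] X,
          Tendsto (fun m : ℕ => zassenhausProd C' A B 2 m t) atTop (𝓝 P') ∧
          Tendsto (fun m : ℕ => zassenhausProd C A B 2 m t) atTop (𝓝 P) ∧
          Tendsto (fun m : ℕ => zassenhausProd D A B 3 m t) atTop (𝓝 (P' * P)) ∧
          NormedSpace.exp ((t : 𝕜) • ((1 / 2 : 𝕜) • A + (1 / 2 : 𝕜) • B)) =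
            P' * NormedSpace.exp ((t : 𝕜) • ((1 / 2 : 𝕜) • A)) *
              NormedSpace.exp ((t : 𝕜) • ((1 / 2 : 𝕜) • B)) ∧
          NormedSpace.exp ((t : 𝕜) • ((1 / 2 : 𝕜) • B + (1 / 2 : 𝕜) • A)) =
            NormedSpace.exp ((t : 𝕜) • ((1 / 2 : 𝕜) • B)) *
              NormedSpace.exp ((t : 𝕜) • ((1 / 2 : 𝕜) • A)) * P ∧
          NormedSpace.exp ((t : 𝕜) • (A + B)) =
            P' * splitting ![(1 / 2 : 𝕜), (1 / 2 : 𝕜)] ![(1 : 𝕜), (0 : 𝕜)] A B t * P)) := by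
  refine ⟨fun X _ _ _ _ _ A B T hT c₀ c => isCauchySolution_iff A B hT c₀ c, fun j a b => ?_,
    fun X _ _ _ A B => ⟨?_, ?_⟩, ?_⟩
  · refine ⟨zassenhausOfList (defectList a b), zassenhausOfList_mem (defectList_mem a b), ?_⟩
    intro X _ _ _ _ _ A B p hp
    rw [splittingHasOrder_iff] at hp
    refine ⟨fun m => ?_, ?_, fun m T hT => ?_⟩
    · simp only [exp_sub_splitting_mul]
      simpa only [one_mul] using
        (listExp_isBigO_one (𝕜 := 𝕜) ((schemeList a b).map (lieEval A B))).mul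
          (listExp_sub_zassenhausProd_isBigO A B hp m)
    · obtain ⟨r, hr, h⟩ := tendsto_zassenhausProd A B hp
      refine ⟨r, hr, fun t ht => ?_⟩
      rw [← splitting_mul_defect A B a b]
      exact (h t ht).const_mul _
    · obtain ⟨K, hK⟩ := norm_listExp_sub_zassenhausProd_le A B hp m hT
      obtain ⟨M, hM⟩ := (isCompact_Icc (a := 0) (b := T)).exists_bound_of_continuousOn
        (continuous_listExp (𝕜 := 𝕜) ((schemeList a b).map (lieEval A B))).continuousOn
      refine ⟨M * K, fun c₀ c hc t ht => ?_⟩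
      have hMt := hM t ht
      have hKt := hK t (by rw [abs_of_nonneg ht.1]; exact ht.2)
      rw [abs_of_nonneg ht.1] at hKt
      rw [(isCauchySolution_iff A B hT c₀ c).1 hc t ht, ← sub_apply,
        exp_sub_splitting_mul]
      refine (ContinuousLinearMap.le_opNorm _ _).trans ?_
      gcongr
      rw [mul_assoc]
      exact (norm_mul_le _ _).trans
        (mul_le_mul hMt hKt (norm_nonneg _) ((norm_nonneg _).trans hMt))
  · rw [splittingHasOrder_iff]
    exact listExp_sub_one_isBigO A B logDerivCoeff_defectList_trotter
  · rw [splittingHasOrder_iff]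
    exact listExp_sub_one_isBigO A B logDerivCoeff_defectList_strang
  · refine ⟨zassenhausOfList (leftHalfList 𝕜), zassenhausOfList (rightHalfList 𝕜),
      zassenhausOfList (leftHalfList 𝕜 ++ rightHalfList 𝕜), fun k =>
        ⟨zassenhausOfList_mem (fun c hc => halfList_mem c (List.mem_append_left _ hc)) k,
          zassenhausOfList_mem (fun c hc => halfList_mem c (List.mem_append_right _ hc)) k,
          zassenhausOfList_mem halfList_mem k⟩, ?_⟩
    intro X _ _ _ A B
    have hl := listExp_sub_one_isBigO A B (logDerivCoeff_leftHalfList (𝕜 := 𝕜))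
    have hr := listExp_sub_one_isBigO A B (logDerivCoeff_rightHalfList (𝕜 := 𝕜))
    have hd := listExp_sub_one_isBigO A B (logDerivCoeff_halfList (𝕜 := 𝕜))
    refine ⟨fun m => ?_, ?_⟩
    · have hlm := listExp_sub_zassenhausProd_isBigO A B hl m
      have hrm := listExp_sub_zassenhausProd_isBigO A B hr m
      have hdm := listExp_sub_zassenhausProd_isBigO A B hd m
      have hpow : (fun t : ℝ => t ^ (m + 1)) =O[𝓝 0] fun _ => (1 : ℝ) := by
        simpa using isBigO_pow_pow_of_le (Nat.zero_le (m + 1))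
      refine ⟨?_, ?_, ?_⟩
      · have := (hlm.mul (listExp_isBigO_one (𝕜 := 𝕜) [(1 / 2 : 𝕜) • A])).mul
          (listExp_isBigO_one (𝕜 := 𝕜) [(1 / 2 : 𝕜) • B])
        simp only [mul_one] at this
        refine this.congr_left fun t => ?_
        simp only [listExp, List.map_cons, List.map_nil, List.prod_singleton]
        rw [exp_half_eq_left A B]
        simp only [listExp, sub_mul]
      · have := (listExp_isBigO_one (𝕜 := 𝕜) [(1 / 2 : 𝕜) • B, (1 / 2 : 𝕜) • A]).mul hrm
        simp only [one_mul] at this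
        refine this.congr_left fun t => ?_
        rw [exp_half_eq_right A B, mul_sub]
        simp only [listExp, List.map_cons, List.map_nil, List.prod_cons, List.prod_nil, mul_one]
      -- With defects `L, R` and partial products `P', P`, `D` the claim follows from `P' P - D =
      -- -(L - P') P - L (R - P) + (L R - D)`; `hz` is the boundedness of `P`.
      · have hz := ((hrm.trans hpow).sub
          (listExp_isBigO_one (𝕜 := 𝕜) ((rightHalfList 𝕜).map (lieEval A B)))).neg_left
        have h₁ := (hlm.mul hz).neg_left
        have h₂ := ((listExp_isBigO_one (𝕜 := 𝕜) ((leftHalfList 𝕜).map (lieEval A B))).mul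
          hrm).neg_left
        simp only [mul_one] at h₁
        simp only [one_mul] at h₂
        refine ((h₁.add h₂).add hdm).congr_left fun t => ?_
        rw [List.map_append, listExp_append]
        noncomm_ring
    · obtain ⟨r₁, hr₁, h₁⟩ := tendsto_zassenhausProd A B hl
      obtain ⟨r₂, hr₂, h₂⟩ := tendsto_zassenhausProd A B hr
      obtain ⟨r₃, hr₃, h₃⟩ := tendsto_zassenhausProd A B hd
      refine ⟨min r₁ (min r₂ r₃), by positivity, fun t ht => ?_⟩
      rw [lt_min_iff, lt_min_iff] at ht
      have h₃' := h₃ t ht.2.2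
      rw [List.map_append, listExp_append] at h₃'
      -- The limits are the defects themselves, so the exact relations are algebraic identities
      -- between exponentials.
      exact ⟨_, _, h₁ t ht.1, h₂ t ht.2.1, h₃', exp_half_eq_left A B _, exp_half_eq_right A B _,
        exp_eq_half_mul_strang_mul_half A B t⟩
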